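/- Let $V$ be a finite-dimensional real inner product space and let $X_1,X_2,\dots$ be independent, identically distributed random vectors in $V$. Let $\Lambda(\lambda)=\log\mathbb{E}\big(e^{\langle\lambda,X_1\rangle}\big)$ and $\Psi(\lambda)=\mathbb{E}_Z\big(\Lambda(Z\lambda)\big)$ with $Z\sim N(0,1)$, and assume that $\Lambda(\lambda)<\infty$ and $\Psi(\lambda)<\infty$ for all $\lambda\in V$. (This holds, for instance, if $X_1$ is bounded.) Let $\mathbb{S}=\prod_{n=1}^\infty\mathbb{S}^{n-1}$, where $\mathbb{S}^{n-1}$ is the unit sphere of $\mathbb{R}^n$, and let $\sigma$ be any probability measure on $\mathbb{S}$ whose $n$-th marginal is the uniform probability measure on $\mathbb{S}^{n-1}$ for every $n\ge 1$. For $\theta=(\theta^n)_{n\ge1}\in\mathbb{S}$ put $$W_n^{\theta^n}=\frac1{\sqrt n}\sum_{i=1}^n\theta_i^nX_i .$$ Then for $\sigma$-almost every $\theta$ the sequence $(W_n^{\theta^n})_{n\ge1}$ satisfies the large deviation principle in $V$ at speed $n$ with good rate function $$\Psi^*(v)=\sup_{\lambda\in V}\{\langle v,\lambda\rangle-\Psi(\lambda)\}.$$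 That is, $\Psi^*:V\to[0,\infty]$ is lower semicontinuous, $\{\Psi^*\le a\}$ is compact for every $a\in\mathbb{R}$, and for every closed $F\subseteq V$ and every open $G\subseteq V$ $$\limsup_{n\to\infty}\frac1n\log\mathbb{P}(W_n^{\theta^n}\in F)\le-\inf_{v\in F}\Psi^*(v),\qquad \liminf_{n\to\infty}\frac1n\log\mathbb{P}(W_n^{\theta^n}\in G)\ge-\inf_{v\in G}\Psi^*(v).$$ -/

import Mathlib

open MeasureTheory ProbabilityTheory Filter Topology

noncomputable section

namespace WeightedLDP

/-- A good rate function: a lower semicontinuous function with values in `[0, ∞]` all of whose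
sublevel sets at finite levels are compact. -/
structure IsGoodRateFunction {E : Type*} [TopologicalSpace E] (I : E → EReal) : Prop where
  nonneg : ∀ x, 0 ≤ I x
  lowerSemicontinuous : LowerSemicontinuous I
  isCompact_sublevel : ∀ a : ℝ, IsCompact {x | I x ≤ (a : EReal)}

/-- The large deviation principle at speed `a n` with good rate function `I`, for a sequence of
measures `μ n`. Here `ENNReal.log 0 = ⊥` and an infimum over the empty set is `⊤`. -/
structure SatisfiesLDP {E : Type*} [TopologicalSpace E] [MeasurableSpace E]
    (μ : ℕ → Measure E) (a : ℕ → ℝ) (I : E → EReal) : Prop where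
  goodRate : IsGoodRateFunction I
  upper_bound : ∀ F : Set E, IsClosed F →
    limsup (fun n => ENNReal.log (μ n F) / (a n : EReal)) atTop ≤ -(⨅ x ∈ F, I x)
  lower_bound : ∀ G : Set E, IsOpen G →
    -(⨅ x ∈ G, I x) ≤ liminf (fun n => ENNReal.log (μ n G) / (a n : EReal)) atTop

/-- The unit sphere of `ℝ^(n+1)`. -/
abbrev WeightSphere (n : ℕ) : Type := Metric.sphere (0 : EuclideanSpace ℝ (Fin (n + 1))) 1

/-- Triangular arrays of unit vectors. The row with index `n` has length `n + 1`, so the rows have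
lengths `1, 2, 3, …`. -/
abbrev WeightArray : Type := (n : ℕ) → WeightSphere n

/-- The uniform probability measure on the unit sphere of `ℝ^(n+1)`: normalized surface measure. -/
def uniformSphere (n : ℕ) : Measure (WeightSphere n) :=
  ((volume : Measure (EuclideanSpace ℝ (Fin (n + 1)))).toSphere Set.univ)⁻¹ •
    (volume : Measure (EuclideanSpace ℝ (Fin (n + 1)))).toSphere

section

variable {V : Type*} [NormedAddCommGroup V] [InnerProductSpace ℝ V]
  {Ω : Type*}

/-- The weighted sum of `X 0, …, X n` with the weights in the row of length `n + 1`, divided by the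
square root of `n + 1`. -/
def weightedSum (X : ℕ → Ω → V) (θ : WeightArray) (n : ℕ) (ω : Ω) : V :=
  (Real.sqrt ((n : ℝ) + 1))⁻¹ • ∑ i : Fin (n + 1), (θ n).1 i • X i ω

/-- The logarithmic moment generating function `l ↦ log E[exp ⟨l, Y⟩]` of a random vector `Y`. -/
def logMGF [MeasurableSpace Ω] (Y : Ω → V) (P : Measure Ω) (l : V) : ℝ :=
  Real.log (∫ ω, Real.exp (inner ℝ l (Y ω)) ∂P)

/-- The Gaussian average `l ↦ E[L (Z l)]` with `Z` standard normal. -/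
def gaussianAverage (L : V → ℝ) (l : V) : ℝ :=
  ∫ z : ℝ, L (z • l) ∂(gaussianReal 0 1)

/-- The Legendre transform of `f`, with values in the extended reals. -/
def legendre (f : V → ℝ) (v : V) : EReal :=
  ⨆ l : V, ((inner ℝ v l - f l : ℝ) : EReal)

end

end WeightedLDP

end

/-! Fix the weights. By independence, the normalised log-moment generating function of the weighted
sum at speed n is the average (1/n) ∑ Λ(√n θᵢ λ). A uniform point of the sphere is a normalised
standard Gaussian vector Z/‖Z‖ (`uniformSphere_eq_gaussian`), so the numbers √n θᵢ behave like
independent normals and the average should tend to Ψ(λ). As Ψ is finite and differentiable along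
lines, the Gärtner–Ellis theorem (`satisfiesLDP_of_tendsto_cgf`) then gives the large deviation
principle. Its lower bound rests on `eventually_exp_le_ball` at gradients of Ψ and on
`exists_gradient_near`, which says that gradients suffice.

The convergence must be almost sure although nothing is known about the joint law of the rows. The
deviation probabilities are therefore shown to be summable (`tsum_uniformSphere_ne_top`), and
Borel–Cantelli applies. Summability comes from a fourth-moment Markov bound of order n⁻². The fourth
moments cost no extra assumption: a convex function all of whose dilations are Gaussian integrable
is O(exp(c z²)) for every c > 0 (`exists_abs_le_mul_exp_sq`).

Convexity also removes the random factor √n/‖Z‖ (`abs_sub_le_of_convexOn`), passes from countably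
many λ to all λ (`tendsto_of_convexOn_of_dense`), and dominates the derivatives under the Gaussian
integral (`differentiableAt_gaussianAverage_line`). -/

namespace WeightedLDP

/-! ### The Legendre transform -/

section Legendre

variable {V : Type*} [NormedAddCommGroup V] [InnerProductSpace ℝ V] {f : V → ℝ}

lemma le_legendre (f : V → ℝ) (v l : V) : ((inner ℝ v l - f l : ℝ) : EReal) ≤ legendre f v :=
  le_iSup (fun l : V => ((inner ℝ v l - f l : ℝ) : EReal)) l

lemma legendre_nonneg (h0 : f 0 = 0) (v : V) : 0 ≤ legendre f v := by
  simpa [h0] using le_legendre f v 0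

lemma lowerSemicontinuous_legendre (f : V → ℝ) : LowerSemicontinuous (legendre f) := by
  refine lowerSemicontinuous_iSup fun l => Continuous.lowerSemicontinuous ?_
  exact continuous_coe_real_ereal.comp (by fun_prop)

variable [FiniteDimensional ℝ V]

/-- Finitely many half-spaces cut out a compact set. -/
lemma exists_finset_isCompact_halfspaces (f : V → ℝ) (a : ℝ) :
    ∃ S : Finset V, IsCompact {y : V | ∀ l ∈ S, inner ℝ y l - f l ≤ a} := by
  classical
  let b := stdOrthonormalBasis ℝ V
  -- The directions ± b i bound every coordinate, so the half-spaces cut out a box.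
  refine ⟨Finset.univ.image b ∪ Finset.univ.image (fun i => - b i), ?_⟩
  refine Metric.isCompact_of_isClosed_isBounded ?_ ?_
  · have : {y : V | ∀ l ∈ Finset.univ.image b ∪ Finset.univ.image (fun i => - b i),
        inner ℝ y l - f l ≤ a} =
        ⋂ l ∈ Finset.univ.image b ∪ Finset.univ.image (fun i => - b i),
          {y : V | inner ℝ y l - f l ≤ a} := by
      ext y; simp only [Set.mem_ofPred_eq, Set.mem_iInter]
    rw [this]
    exact isClosed_biInter fun l _ => isClosed_le (by fun_prop) continuous_const
  · rw [isBounded_iff_forall_norm_le]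
    refine ⟨∑ i, (|a + f (b i)| + |a + f (- b i)|), fun y hy => ?_⟩
    have h1 : ∀ i, |inner ℝ (b i) y| ≤ |a + f (b i)| + |a + f (- b i)| := by
      intro i
      have h1 := hy (b i) (by simp)
      have h2 := hy (- b i) (by simp)
      rw [inner_neg_right] at h2
      rw [real_inner_comm]
      have := le_abs_self (a + f (b i))
      have := le_abs_self (a + f (- b i))
      have := abs_nonneg (a + f (b i))
      have := abs_nonneg (a + f (- b i))
      rw [abs_le]
      constructor <;> linarith
    calc ‖y‖ = ‖∑ i, inner ℝ (b i) y • b i‖ := by rw [b.sum_repr']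
      _ ≤ ∑ i, ‖inner ℝ (b i) y • b i‖ := norm_sum_le _ _
      _ ≤ _ := by
        refine Finset.sum_le_sum fun i _ => ?_
        rw [norm_smul, b.norm_eq_one, mul_one]
        exact h1 i

lemma isGoodRateFunction_legendre (h0 : f 0 = 0) : IsGoodRateFunction (legendre f) where
  nonneg := legendre_nonneg h0
  lowerSemicontinuous := lowerSemicontinuous_legendre f
  isCompact_sublevel a := by
    obtain ⟨S, hS⟩ := exists_finset_isCompact_halfspaces f a
    refine hS.of_isClosed_subset ((lowerSemicontinuous_legendre f).isClosed_preimage a) ?_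
    intro y hy l _
    exact_mod_cast (le_legendre f y l).trans hy

/-- A closed set on which the Legendre transform exceeds `a` is covered by finitely many of the
half-spaces witnessing this. -/
lemma exists_finset_cover_of_lt_legendre {F : Set V} (hF : IsClosed F) {a : ℝ}
    (ha : ∀ x ∈ F, (a : EReal) < legendre f x) :
    ∃ S : Finset V, F ⊆ ⋃ l ∈ S, {y : V | a + f l ≤ inner ℝ l y} := by
  classical
  obtain ⟨S, hS⟩ := exists_finset_isCompact_halfspaces f a
  obtain ⟨T, hT⟩ := (hS.inter_left hF).elim_finite_subcover
    (fun l : V => {y : V | a < inner ℝ y l - f l})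
    (fun l => isOpen_lt continuous_const (by fun_prop)) (by
      intro x hx
      obtain ⟨l, hl⟩ := lt_iSup_iff.1 (ha x hx.1)
      exact Set.mem_iUnion.2 ⟨l, by exact_mod_cast hl⟩)
  -- Inside the compact set `T` covers; outside it, the constraint from `S` that fails is itself the
  -- witness.
  refine ⟨S ∪ T, fun x hx => ?_⟩
  simp only [Set.mem_iUnion, Set.mem_ofPred_eq]
  by_cases h : ∀ l ∈ S, inner ℝ x l - f l ≤ a
  · have := hT ⟨hx, h⟩
    simp only [Set.mem_iUnion, Set.mem_ofPred_eq] at this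
    obtain ⟨l, hl, h2⟩ := this
    exact ⟨l, Finset.mem_union_right _ hl, by rw [real_inner_comm]; linarith⟩
  · push Not at h
    obtain ⟨l, hl, h2⟩ := h
    exact ⟨l, Finset.mem_union_left _ hl, by rw [real_inner_comm]; linarith⟩

/-- Every point where the Legendre transform of a nonnegative, continuous, directionally
differentiable function `f` is finite is approximated by gradients of `f`, without increasing the
value of the Legendre transform. -/
lemma exists_gradient_near (hc : Continuous f) (hf : ∀ l, 0 ≤ f l) (h0 : f 0 = 0)
    (hd : ∀ l e : V, DifferentiableAt ℝ (fun t : ℝ => f (l + t • e)) 0)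
    {v : V} {c : ℝ} (hv : legendre f v ≤ c) {δ : ℝ} (hδ : 0 < δ) :
    ∃ u l : V, ‖u - v‖ < δ ∧ inner ℝ u l - f l ≤ c ∧
      ∀ e : V, HasDerivAt (fun t : ℝ => f (l + t • e)) (inner ℝ u e) 0 := by
  have hc0 : 0 ≤ c := by exact_mod_cast (legendre_nonneg h0 v).trans hv
  -- Let l minimise the coercive function `g` below and put u = v - ε • l, which makes u the
  -- gradient of f at l. From g l ≤ g 0 = 0 follows ε/2 ‖l‖² ≤ ⟨v, l⟩ - f l ≤ c, hence ‖u - v‖² ≤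
  -- 2εc; this dictates ε.
  obtain ⟨ε, hε, hεδ⟩ : ∃ ε : ℝ, 0 < ε ∧ 2 * ε * c < δ ^ 2 := by
    refine ⟨δ ^ 2 / (4 * (c + 1)), by positivity, ?_⟩
    rw [show 2 * (δ ^ 2 / (4 * (c + 1))) * c = δ ^ 2 * (c / (2 * (c + 1))) by field_simp; ring]
    have : c / (2 * (c + 1)) < 1 := by rw [div_lt_one (by positivity)]; linarith
    nlinarith [sq_pos_of_pos hδ]
  let g : V → ℝ := fun l => f l + ε / 2 * ‖l‖ ^ 2 - inner ℝ v l
  have hgc : Continuous g := by fun_prop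
  have hg : Tendsto g (cocompact V) atTop := by
    have h1 : Tendsto (fun l : V => ‖l‖ * (ε / 2 * ‖l‖ - ‖v‖)) (cocompact V) atTop := by
      have hn := tendsto_norm_cocompact_atTop (E := V)
      refine hn.atTop_mul_atTop₀ ?_
      exact tendsto_atTop_add_const_right _ (-‖v‖) (hn.const_mul_atTop (by positivity))
    refine tendsto_atTop_mono (fun l => ?_) h1
    have := real_inner_le_norm v l
    have := hf l
    simp only [g]
    nlinarith
  obtain ⟨l, hl⟩ := hgc.exists_forall_le hg
  have hlmin : inner ℝ v l - f l ≤ c := by exact_mod_cast (le_legendre f v l).trans hv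
  have hl0 := hl 0
  simp only [g, h0, norm_zero, inner_zero_right] at hl0
  refine ⟨v - ε • l, l, ?_, ?_, fun e => ?_⟩
  · rw [sub_sub_cancel_left, norm_neg, norm_smul, Real.norm_of_nonneg hε.le]
    refine lt_of_pow_lt_pow_left₀ 2 hδ.le ?_
    nlinarith
  · rw [inner_sub_left, real_inner_smul_left, real_inner_self_eq_norm_sq]
    nlinarith [sq_nonneg ‖l‖]
  · have h1 := (hd l e).hasDerivAt
    have h2 : HasDerivAt (fun t : ℝ => l + t • e) e 0 := by
      simpa using ((hasDerivAt_id (0 : ℝ)).smul_const e).const_add l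
    have h3 := h2.norm_sq
    have h4 : HasDerivAt (fun t : ℝ => inner ℝ v (l + t • e)) (inner ℝ v e) 0 := by
      simpa using (hasDerivAt_const (0 : ℝ) v).inner ℝ h2
    have h5 := (h1.add (h3.const_mul (ε / 2))).sub h4
    have hmin : IsLocalMin (fun t : ℝ => g (l + t • e)) 0 :=
      Filter.Eventually.of_forall fun t => by simpa using hl (l + t • e)
    have h6 := hmin.hasDerivAt_eq_zero h5
    simp only [zero_smul, add_zero] at h6
    have h7 : deriv (fun t : ℝ => f (l + t • e)) 0 = inner ℝ (v - ε • l) e := by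
      rw [inner_sub_left, real_inner_smul_left]; linarith
    rwa [h7] at h1

end Legendre

/-! ### The Gärtner–Ellis theorem for a differentiable limit -/

section GartnerEllis

lemma log_div_le_of_le_exp {x : ENNReal} {r b : ℝ} (hr : 0 < r)
    (h : x ≤ ENNReal.ofReal (Real.exp (r * b))) : ENNReal.log x / (r : EReal) ≤ b := by
  rw [EReal.div_le_iff_le_mul (by exact_mod_cast hr) (EReal.coe_ne_top r)]
  refine (ENNReal.log_le_log h).trans ?_
  rw [ENNReal.log_ofReal, if_neg (not_le.2 (Real.exp_pos _)), Real.log_exp]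
  norm_cast

lemma le_log_div_of_exp_le {x : ENNReal} {r b : ℝ} (hr : 0 < r)
    (h : ENNReal.ofReal (Real.exp (r * b)) ≤ x) : (b : EReal) ≤ ENNReal.log x / (r : EReal) := by
  rw [EReal.le_div_iff_mul_le (by exact_mod_cast hr) (EReal.coe_ne_top r)]
  refine le_trans ?_ (ENNReal.log_le_log h)
  rw [ENNReal.log_ofReal, if_neg (not_le.2 (Real.exp_pos _)), Real.log_exp, mul_comm]
  norm_cast

lemma tendsto_const_mul_exp_neg_mul {a : ℕ → ℝ} (ha : Tendsto a atTop atTop) {c : ℝ} (hc : 0 < c)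
    (K : ℝ) : Tendsto (fun n => K * Real.exp (-(a n * c))) atTop (𝓝 0) := by
  have h := Real.tendsto_exp_neg_atTop_nhds_zero.comp (ha.atTop_mul_const hc)
  simpa using h.const_mul K

variable {V : Type*} [NormedAddCommGroup V] [InnerProductSpace ℝ V] [FiniteDimensional ℝ V]
  [MeasurableSpace V] {μ : ℕ → Measure V} [∀ n, IsProbabilityMeasure (μ n)]
  {a : ℕ → ℝ} {f : V → ℝ}

/-- Chernoff's bound in each of finitely many half-spaces covering F. Of the slack c + z, one half
pays for the convergence of the cgf, the other beats the number of half-spaces. -/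
lemma upper_bound_of_tendsto_cgf (ha : Tendsto a atTop atTop) (hpos : ∀ n, 0 < a n)
    (hint : ∀ n l, Integrable (fun x => Real.exp (a n * inner ℝ l x)) (μ n))
    (hlim : ∀ l, Tendsto (fun n => cgf (fun x => inner ℝ l x) (μ n) (a n) / a n) atTop
      (𝓝 (f l))) {F : Set V} (hF : IsClosed F) :
    limsup (fun n => ENNReal.log (μ n F) / (a n : EReal)) atTop ≤
      -(⨅ x ∈ F, legendre f x) := by
  rw [EReal.le_neg, ← EReal.ge_of_forall_gt_iff_ge]
  intro c hc
  rw [EReal.le_neg, ← EReal.coe_neg, ← EReal.le_of_forall_lt_iff_le]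
  intro z hz
  have hz' : 0 < c + z := by have : -c < z := by exact_mod_cast hz
                             linarith
  obtain ⟨S, hS⟩ := exists_finset_cover_of_lt_legendre (f := f) hF (a := c)
    (fun x hx => hc.trans_le (iInf₂_le x hx))
  refine limsup_le_of_le (by isBoundedDefault) ?_
  have h1 : ∀ᶠ n in atTop, ∀ l ∈ S, cgf (fun x => inner ℝ l x) (μ n) (a n) / a n <
      f l + (c + z) / 2 := by
    rw [eventually_all_finset]
    intro l _
    exact (hlim l).eventually_lt_const (by linarith)
  have h2 : ∀ᶠ n in atTop, S.card * Real.exp (-(a n * ((c + z) / 2))) < 1 :=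
    (tendsto_const_mul_exp_neg_mul ha (by linarith : 0 < (c + z) / 2) S.card).eventually_lt_const
      one_pos
  filter_upwards [h1, h2] with n h1 h2
  refine log_div_le_of_le_exp (hpos n) ?_
  rw [← ofReal_measureReal (measure_ne_top _ _)]
  refine ENNReal.ofReal_le_ofReal ?_
  calc (μ n).real F ≤ (μ n).real (⋃ l ∈ S, {y : V | c + f l ≤ inner ℝ l y}) :=
        measureReal_mono hS (measure_ne_top _ _)
    _ ≤ ∑ l ∈ S, (μ n).real {y : V | c + f l ≤ inner ℝ l y} :=
        measureReal_biUnion_finset_le _ _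
    _ ≤ ∑ l ∈ S, Real.exp (a n * z) * Real.exp (-(a n * ((c + z) / 2))) := by
        refine Finset.sum_le_sum fun l hl => ?_
        refine (measure_ge_le_exp_cgf _ (hpos n).le (hint n l)).trans ?_
        rw [← Real.exp_add]
        refine Real.exp_le_exp.2 ?_
        have := h1 l hl
        rw [div_lt_iff₀ (hpos n)] at this
        linarith
    _ = Real.exp (a n * z) * (S.card * Real.exp (-(a n * ((c + z) / 2)))) := by
        rw [Finset.sum_const, nsmul_eq_mul]; ring
    _ ≤ Real.exp (a n * z) * 1 := by gcongr
    _ = _ := mul_one _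

/-- Points at distance at least `δ` from `u` are separated from `u` in one of finitely many
directions. -/
lemma exists_directions (V : Type*) [NormedAddCommGroup V] [InnerProductSpace ℝ V]
    [FiniteDimensional ℝ V] {δ : ℝ} (hδ : 0 < δ) :
    ∃ (ι : Type) (_ : Fintype ι) (e : ι → V) (η : ℝ), 0 < η ∧
      ∀ u x : V, δ ≤ ‖x - u‖ → ∃ i, inner ℝ u (e i) + η ≤ inner ℝ x (e i) := by
  let b := stdOrthonormalBasis ℝ V
  let d := Module.finrank ℝ V
  -- If all d coordinates of x - u were at most δ/(d+1) in size, its norm would be below δ. The +1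
  -- also covers d = 0.
  refine ⟨Fin d ⊕ Fin d, inferInstance, Sum.elim b (fun i => - b i), δ / (d + 1), by positivity,
    fun u x hx => ?_⟩
  by_contra! h
  have h1 : ∀ i, |inner ℝ (b i) (x - u)| ≤ δ / (d + 1) := by
    intro i
    have h1 := h (Sum.inl i)
    have h2 := h (Sum.inr i)
    simp only [Sum.elim_inl, Sum.elim_inr, inner_neg_right] at h1 h2
    rw [real_inner_comm, inner_sub_left, abs_le]
    constructor <;> linarith
  have h2 : ‖x - u‖ ≤ d * (δ / (d + 1)) := by
    calc ‖x - u‖ = ‖∑ i, inner ℝ (b i) (x - u) • b i‖ := by rw [b.sum_repr']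
      _ ≤ ∑ i, ‖inner ℝ (b i) (x - u) • b i‖ := norm_sum_le _ _
      _ ≤ ∑ i : Fin d, δ / (d + 1) := by
        refine Finset.sum_le_sum fun i _ => ?_
        rw [norm_smul, b.norm_eq_one, mul_one]
        exact h1 i
      _ = _ := by simp
  have h3 : (d : ℝ) * (δ / (d + 1)) < δ := by
    rw [mul_div_assoc', div_lt_iff₀ (by positivity)]
    nlinarith
  linarith

lemma exists_pos_lt_of_hasDerivAt {g : ℝ → ℝ} {g' η : ℝ} (hg : HasDerivAt g g' 0) (hη : 0 < η) :
    ∃ t, 0 < t ∧ g t - g 0 < t * (g' + η) := by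
  have h : Tendsto (slope g 0) (𝓝[>] 0) (𝓝 g') := (hasDerivAt_iff_tendsto_slope.1 hg).mono_left
    (nhdsWithin_mono (0 : ℝ) (fun x (hx : 0 < x) => ne_of_gt hx))
  obtain ⟨t, ht, ht0⟩ := ((h.eventually_lt_const (lt_add_of_pos_right g' hη)).and
    self_mem_nhdsWithin).exists
  refine ⟨t, ht0, ?_⟩
  rw [slope_def_field, sub_zero, div_lt_iff₀ ht0] at ht
  linarith

variable [BorelSpace V]

/-- The tilt by l concentrates at the gradient u, shown here without forming the tilted measure. Off
the ball, x exceeds u by η in some direction e i, so the integrand is at most a constant times the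
one for l + t i • e i; differentiability of f at l makes that contribution exponentially smaller
than the whole integral. Hence the ball carries at least half of it. -/
lemma eventually_exp_le_ball (ha : Tendsto a atTop atTop) (hpos : ∀ n, 0 < a n)
    (hint : ∀ n l, Integrable (fun x => Real.exp (a n * inner ℝ l x)) (μ n))
    (hlim : ∀ l, Tendsto (fun n => cgf (fun x => inner ℝ l x) (μ n) (a n) / a n) atTop
      (𝓝 (f l))) {u l : V}
    (hul : ∀ e : V, HasDerivAt (fun t : ℝ => f (l + t • e)) (inner ℝ u e) 0)
    {δ κ : ℝ} (hδ : 0 < δ) (hκ : 0 < κ) :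
    ∀ᶠ n in atTop, Real.exp (a n * -(inner ℝ u l - f l + κ)) ≤ (μ n).real (Metric.ball u δ) := by
  -- A smaller ball only strengthens the claim; on it ⟨l, x - u⟩ ≤ κ/2.
  wlog hδκ : δ * ‖l‖ ≤ κ / 2 generalizing δ
  · have h1 : 0 < min δ (κ / 2 / (‖l‖ + 1)) := by positivity
    have h2 : min δ (κ / 2 / (‖l‖ + 1)) * ‖l‖ ≤ κ / 2 := by
      calc min δ (κ / 2 / (‖l‖ + 1)) * ‖l‖ ≤ κ / 2 / (‖l‖ + 1) * (‖l‖ + 1) := by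
            gcongr
            · exact min_le_right _ _
            · linarith
        _ = κ / 2 := by field_simp
    filter_upwards [this h1 h2] with n hn
    exact hn.trans (measureReal_mono (Metric.ball_subset_ball (min_le_left _ _)))
  obtain ⟨ι, _, e, η, hη, he⟩ := exists_directions V hδ
  choose t ht0 ht using fun i => exists_pos_lt_of_hasDerivAt (hul (e i)) hη
  simp only [zero_smul, add_zero] at ht
  -- The exponential rate at which the i-th outside term loses to the full integral; half of it is
  -- given up to the convergence of the cgfs.
  let c : ι → ℝ := fun i => t i * (inner ℝ u (e i) + η) - (f (l + t i • e i) - f l)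
  have hc : ∀ i, 0 < c i := fun i => by have := ht i; simp only [c]; linarith
  let L : V → ℕ → ℝ := fun l n => cgf (fun x => inner ℝ l x) (μ n) (a n)
  have hL : ∀ l n, ∫ x, Real.exp (a n * inner ℝ l x) ∂(μ n) = Real.exp (L l n) := fun l n =>
    (exp_cgf (hint n l)).symm
  have h1 : ∀ᶠ n in atTop, ∀ i, L (l + t i • e i) n / a n - L l n / a n <
      f (l + t i • e i) - f l + c i / 2 := by
    rw [eventually_all]
    intro i
    exact ((hlim _).sub (hlim l)).eventually_lt_const (by have := hc i; linarith)
  have h2 : ∀ᶠ n in atTop, ∑ i, 1 * Real.exp (-(a n * (c i / 2))) < 1 / 2 := by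
    have : Tendsto (fun n => ∑ i, 1 * Real.exp (-(a n * (c i / 2)))) atTop (𝓝 (∑ i : ι, 0)) :=
      tendsto_finsetSum _ fun i _ =>
        tendsto_const_mul_exp_neg_mul ha (by have := hc i; linarith) 1
    exact this.eventually_lt_const (by simp)
  -- One κ/4 pays for the convergence at l, another absorbs the factor 1/2; the remaining κ/2 is the
  -- variation of ⟨l, ·⟩ on the ball.
  have h3 : ∀ᶠ n in atTop, f l - κ / 4 < L l n / a n :=
    (hlim l).eventually_const_lt (by linarith)
  have h4 : ∀ᶠ n in atTop, 1 * Real.exp (-(a n * (κ / 4))) < 1 / 2 :=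
    (tendsto_const_mul_exp_neg_mul ha (by linarith) 1).eventually_lt_const (by norm_num)
  filter_upwards [h1, h2, h3, h4] with n h1 h2 h3 h4
  have hpt : ∀ x : V, Real.exp (a n * inner ℝ l x) ≤
      (Metric.ball u δ).indicator (fun _ => Real.exp (a n * (inner ℝ u l + κ / 2))) x +
      ∑ i, Real.exp (-(a n * (t i * (inner ℝ u (e i) + η)))) *
        Real.exp (a n * inner ℝ (l + t i • e i) x) := by
    intro x
    by_cases hx : x ∈ Metric.ball u δ
    · rw [Set.indicator_of_mem hx]
      refine le_add_of_le_of_nonneg (Real.exp_le_exp.2 ?_)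
        (Finset.sum_nonneg fun i _ => by positivity)
      have h5 : inner ℝ l (x - u) ≤ κ / 2 := by
        refine (real_inner_le_norm _ _).trans (le_trans ?_ hδκ)
        rw [mul_comm]
        gcongr
        exact (mem_ball_iff_norm.1 hx).le
      rw [inner_sub_right, real_inner_comm u] at h5
      exact mul_le_mul_of_nonneg_left (by linarith) (hpos n).le
    · rw [Set.indicator_of_notMem hx, zero_add]
      rw [mem_ball_iff_norm, not_lt] at hx
      obtain ⟨i, hi⟩ := he u x hx
      refine le_trans ?_ (Finset.single_le_sum (f := fun i =>
        Real.exp (-(a n * (t i * (inner ℝ u (e i) + η)))) *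
        Real.exp (a n * inner ℝ (l + t i • e i) x)) (fun i _ => by positivity)
        (Finset.mem_univ i))
      rw [← Real.exp_add]
      refine Real.exp_le_exp.2 ?_
      rw [inner_add_left, real_inner_smul_left, real_inner_comm x (e i)]
      have := mul_le_mul_of_nonneg_left hi (mul_pos (hpos n) (ht0 i)).le
      linarith
  have hInt : ∀ i ∈ Finset.univ, Integrable (fun x =>
      Real.exp (-(a n * (t i * (inner ℝ u (e i) + η)))) *
        Real.exp (a n * inner ℝ (l + t i • e i) x)) (μ n) :=
    fun i _ => (hint n _).const_mul _
  have hInd : Integrable ((Metric.ball u δ).indicator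
      (fun _ : V => Real.exp (a n * (inner ℝ u l + κ / 2)))) (μ n) :=
    (integrable_const _).indicator measurableSet_ball
  have h6 := integral_mono (hint n l) (hInd.add (integrable_finsetSum _ hInt)) hpt
  rw [integral_add' hInd (integrable_finsetSum _ hInt), integral_finsetSum _ hInt,
    integral_indicator_const _ measurableSet_ball, hL, smul_eq_mul] at h6
  simp_rw [integral_const_mul, hL, ← Real.exp_add] at h6
  have h7 : ∑ i, Real.exp (-(a n * (t i * (inner ℝ u (e i) + η))) + L (l + t i • e i) n) ≤
      Real.exp (L l n) * (1 / 2) := by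
    calc _ ≤ ∑ i, Real.exp (L l n) * (1 * Real.exp (-(a n * (c i / 2)))) := by
          refine Finset.sum_le_sum fun i _ => ?_
          rw [one_mul, ← Real.exp_add]
          refine Real.exp_le_exp.2 ?_
          have := h1 i
          rw [← sub_div, div_lt_iff₀ (hpos n)] at this
          have hci : f (l + t i • e i) - f l = t i * (inner ℝ u (e i) + η) - c i := by
            simp only [c]; ring
          rw [hci] at this
          linarith
      _ ≤ _ := by
          rw [← Finset.mul_sum]
          gcongr
  rw [lt_div_iff₀ (hpos n)] at h3
  have h8 : Real.exp (a n * (f l - κ / 2)) ≤ Real.exp (L l n) * (1 / 2) := by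
    calc Real.exp (a n * (f l - κ / 2)) =
        Real.exp ((f l - κ / 4) * a n) * (1 * Real.exp (-(a n * (κ / 4)))) := by
          rw [one_mul, ← Real.exp_add]; ring_nf
      _ ≤ _ := by gcongr
  have h9 : Real.exp (a n * (f l - κ / 2)) ≤
      (μ n).real (Metric.ball u δ) * Real.exp (a n * (inner ℝ u l + κ / 2)) := by linarith
  rw [← div_le_iff₀ (Real.exp_pos _), ← Real.exp_sub] at h9
  refine le_trans (le_of_eq ?_) h9
  ring_nf

lemma lower_bound_of_tendsto_cgf (ha : Tendsto a atTop atTop) (hpos : ∀ n, 0 < a n)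
    (hint : ∀ n l, Integrable (fun x => Real.exp (a n * inner ℝ l x)) (μ n))
    (hlim : ∀ l, Tendsto (fun n => cgf (fun x => inner ℝ l x) (μ n) (a n) / a n) atTop
      (𝓝 (f l)))
    (hc : Continuous f) (hf : ∀ l, 0 ≤ f l) (h0 : f 0 = 0)
    (hd : ∀ l e : V, DifferentiableAt ℝ (fun t : ℝ => f (l + t • e)) 0)
    {G : Set V} (hG : IsOpen G) :
    -(⨅ x ∈ G, legendre f x) ≤
      liminf (fun n => ENNReal.log (μ n G) / (a n : EReal)) atTop := by
  rw [EReal.neg_le, le_iInf₂_iff]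
  intro v hv
  rw [EReal.neg_le, ← EReal.ge_of_forall_gt_iff_ge]
  intro z hz
  obtain ⟨c, hc1, hc2⟩ := EReal.lt_iff_exists_real_btwn.1 (EReal.lt_neg_comm.1 hz)
  have hcz : 0 < -z - c := by
    have : c < -z := by exact_mod_cast hc2
    linarith
  obtain ⟨δ, hδ, hball⟩ := Metric.isOpen_iff.1 hG v hv
  -- v itself need not be a gradient of f; a nearby gradient u has an exponent that is no worse.
  obtain ⟨u, l, huv, hul, hder⟩ := exists_gradient_near hc hf h0 hd hc1.le (half_pos hδ)
  refine le_liminf_of_le (by isBoundedDefault) ?_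
  filter_upwards [eventually_exp_le_ball ha hpos hint hlim hder (half_pos hδ) hcz] with n hn
  refine le_log_div_of_exp_le (hpos n) ?_
  have hsub : Metric.ball u (δ / 2) ⊆ G := by
    refine (Metric.ball_subset_ball' ?_).trans hball
    rw [dist_eq_norm]; linarith
  calc ENNReal.ofReal (Real.exp (a n * z)) ≤ ENNReal.ofReal ((μ n).real (Metric.ball u (δ / 2))) :=
        ENNReal.ofReal_le_ofReal (le_trans (Real.exp_le_exp.2
          (mul_le_mul_of_nonneg_left (by linarith) (hpos n).le)) hn)
    _ = μ n (Metric.ball u (δ / 2)) := ofReal_measureReal (measure_ne_top _ _)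
    _ ≤ μ n G := measure_mono hsub

/-- The Gärtner–Ellis theorem for a limit that is finite, nonnegative and directionally
differentiable everywhere. -/
theorem satisfiesLDP_of_tendsto_cgf (ha : Tendsto a atTop atTop) (hpos : ∀ n, 0 < a n)
    (hint : ∀ n l, Integrable (fun x => Real.exp (a n * inner ℝ l x)) (μ n))
    (hlim : ∀ l, Tendsto (fun n => cgf (fun x => inner ℝ l x) (μ n) (a n) / a n) atTop
      (𝓝 (f l)))
    (hc : Continuous f) (hf : ∀ l, 0 ≤ f l) (h0 : f 0 = 0)
    (hd : ∀ l e : V, DifferentiableAt ℝ (fun t : ℝ => f (l + t • e)) 0) :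
    SatisfiesLDP μ a (legendre f) where
  goodRate := isGoodRateFunction_legendre h0
  upper_bound _ hF := upper_bound_of_tendsto_cgf ha hpos hint hlim hF
  lower_bound _ hG := lower_bound_of_tendsto_cgf ha hpos hint hlim hc hf h0 hd hG

end GartnerEllis

/-! ### Convex functions -/

section Convex

variable {V : Type*} [NormedAddCommGroup V] [NormedSpace ℝ V] [FiniteDimensional ℝ V]

lemma continuous_of_convexOn_univ {f : V → ℝ} (hf : ConvexOn ℝ Set.univ f) : Continuous f :=
  continuousOn_univ.1 (hf.continuousOn isOpen_univ)

/-- An open set is contained in the convex hull of its intersection with a dense set. -/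
lemma subset_convexHull_inter_of_dense {D U : Set V} (hD : Dense D) (hU : IsOpen U) :
    U ⊆ convexHull ℝ (U ∩ D) := by
  rcases U.eq_empty_or_nonempty with rfl | hne
  · simp
  have hcl : U ⊆ closure (U ∩ D) := hD.open_subset_closure_inter hU
  have hspan : affineSpan ℝ (U ∩ D) = ⊤ := by
    have h1 : closure (U ∩ D) ⊆ affineSpan ℝ (U ∩ D) :=
      closure_minimal (subset_affineSpan ℝ _) (AffineSubspace.closed_of_finiteDimensional _)
    have h2 : affineSpan ℝ U ≤ affineSpan ℝ (U ∩ D) := affineSpan_le.2 (hcl.trans h1)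
    rw [hU.affineSpan_eq_top hne] at h2
    exact top_le_iff.1 h2
  have hint := interior_convexHull_nonempty_iff_affineSpan_eq_top.2 hspan
  have h3 := (convex_convexHull ℝ (U ∩ D)).interior_closure_eq_interior_of_nonempty_interior hint
  calc U ⊆ interior (closure (convexHull ℝ (U ∩ D))) :=
        hU.subset_interior_iff.2 (hcl.trans (closure_mono (subset_convexHull ℝ _)))
    _ = interior (convexHull ℝ (U ∩ D)) := h3
    _ ⊆ _ := interior_subset

/-- Convex functions converging on a dense set to a continuous function converge everywhere. -/
lemma tendsto_of_convexOn_of_dense {F : ℕ → V → ℝ} {f : V → ℝ} {D : Set V} (hD : Dense D)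
    (hF : ∀ n, ConvexOn ℝ Set.univ (F n)) (hf : Continuous f)
    (h : ∀ x ∈ D, Tendsto (fun n => F n x) atTop (𝓝 (f x))) (x : V) :
    Tendsto (fun n => F n x) atTop (𝓝 (f x)) := by
  -- x is a convex combination of finitely many points of D in the open set {f < c}, and a convex
  -- function is at most its maximum over them.
  have upper : ∀ x c, f x < c → ∀ᶠ n in atTop, F n x < c := by
    intro x c hc
    have hx := subset_convexHull_inter_of_dense hD (isOpen_lt hf continuous_const)
      (show x ∈ {y | f y < c} from hc)
    obtain ⟨ι, _, w, z, hw0, hw1, hz, rfl⟩ := mem_convexHull_iff_exists_fintype.1 hx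
    have h1 : ∀ᶠ n in atTop, ∀ i, F n (z i) < c :=
      eventually_all.2 fun i => (h (z i) (hz i).2).eventually_lt_const (hz i).1
    filter_upwards [h1] with n hn
    obtain ⟨_, ⟨j, rfl⟩, hi⟩ := (hF n).exists_ge_of_mem_convexHull (Set.subset_univ _)
      (mem_convexHull_iff_exists_fintype.2
        ⟨ι, inferInstance, w, z, hw0, hw1, fun i => Set.mem_range_self (f := z) i, rfl⟩)
    exact hi.trans_lt (hn j)
  refine tendsto_order.2 ⟨fun c hc => ?_, upper x⟩
  -- For the lower bound, reflect x in a nearby d ∈ D: F n x ≥ 2 F n d - F n (2d - x), where `upper`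
  -- controls the last term. The three errors of size κ add up to the gap.
  have hcont : Continuous fun d : V => 2 * f d - f ((2 : ℝ) • d - x) := by fun_prop
  obtain ⟨d, hd, hdD⟩ := hD.exists_mem_open (isOpen_lt (continuous_const (y := c)) hcont)
    ⟨x, by simp only [Set.mem_ofPred_eq, two_smul, add_sub_cancel_right]; linarith⟩ |>.imp
      fun d h => And.symm h
  simp only [Set.mem_ofPred_eq] at hd
  set κ := (2 * f d - f ((2 : ℝ) • d - x) - c) / 3 with hκ
  have hκ0 : 0 < κ := by rw [hκ]; linarith
  filter_upwards [(h d hdD).eventually_const_lt (sub_lt_self (f d) hκ0),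
    upper ((2 : ℝ) • d - x) _ (lt_add_of_pos_right _ hκ0)] with n h1 h2
  have h3 := (hF n).2 (Set.mem_univ x) (Set.mem_univ ((2 : ℝ) • d - x))
    (by norm_num : (0 : ℝ) ≤ 1 / 2) (by norm_num : (0 : ℝ) ≤ 1 / 2) (by norm_num)
  rw [show (1 / 2 : ℝ) • x + (1 / 2 : ℝ) • ((2 : ℝ) • d - x) = d by module] at h3
  simp only [smul_eq_mul] at h3
  linarith

/-- Derivatives on (-1, 1) lie between the secant slopes over [-2, -1] and [1, 2]. The bound uses
only four values of f, so it is integrable whenever they are. -/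
lemma abs_deriv_le_of_convexOn {f : ℝ → ℝ} (hf : ConvexOn ℝ Set.univ f) (hd : Differentiable ℝ f)
    {t : ℝ} (ht : t ∈ Set.Ioo (-1 : ℝ) 1) :
    |deriv f t| ≤ |f 2 - f 1| + |f (-1) - f (-2)| := by
  have h1 := hf.deriv_le_slope (Set.mem_univ t) (Set.mem_univ 1) ht.2 (hd t)
  have h2 := hf.slope_le_deriv (Set.mem_univ (-1)) (Set.mem_univ t) ht.1 (hd t)
  have h3 := hf.slope_mono_adjacent (Set.mem_univ t) (Set.mem_univ 2) ht.2 (by norm_num)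
  have h4 := hf.slope_mono_adjacent (Set.mem_univ (-2)) (Set.mem_univ t) (by norm_num) ht.1
  rw [slope_def_field] at h1 h2
  norm_num at h3 h4
  have := le_abs_self (f 2 - f 1)
  have := neg_abs_le (f (-1) - f (-2))
  have := abs_nonneg (f 2 - f 1)
  have := abs_nonneg (f (-1) - f (-2))
  norm_num at h1 h2
  rw [abs_le]
  constructor <;> linarith

end Convex

/-! ### The logarithmic moment generating function -/

section LogMGF

variable {V : Type*} [NormedAddCommGroup V] [InnerProductSpace ℝ V]
  {Ω : Type*} [MeasurableSpace Ω] {P : Measure Ω} {Y : Ω → V}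

lemma exp_logMGF [NeZero P] (hfin : ∀ l : V, Integrable (fun ω => Real.exp (inner ℝ l (Y ω))) P)
    (l : V) : Real.exp (logMGF Y P l) = ∫ ω, Real.exp (inner ℝ l (Y ω)) ∂P :=
  Real.exp_log (integral_exp_pos (hfin l))

variable [IsProbabilityMeasure P]

lemma logMGF_zero : logMGF Y P 0 = 0 := by simp [logMGF]

/-- Hölder's inequality, obtained by applying convexity of exp pointwise to ⟨x, Y⟩ - A and ⟨y, Y⟩ -
B, whose exponentials have mean one. -/
lemma convexOn_logMGF (hfin : ∀ l : V, Integrable (fun ω => Real.exp (inner ℝ l (Y ω))) P) :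
    ConvexOn ℝ Set.univ (logMGF Y P) := by
  refine ⟨convex_univ, fun x _ y _ a b ha hb hab => ?_⟩
  set A := logMGF Y P x with hA
  set B := logMGF Y P y with hB
  simp only [smul_eq_mul]
  rw [← Real.exp_le_exp, exp_logMGF hfin]
  have hpt : ∀ ω, Real.exp (inner ℝ (a • x + b • y) (Y ω)) ≤
      Real.exp (a * A + b * B) * (a * (Real.exp (-A) * Real.exp (inner ℝ x (Y ω))) +
        b * (Real.exp (-B) * Real.exp (inner ℝ y (Y ω)))) := by
    intro ω
    have h := convexOn_exp.2 (Set.mem_univ (-A + inner ℝ x (Y ω)))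
      (Set.mem_univ (-B + inner ℝ y (Y ω))) ha hb hab
    simp only [smul_eq_mul, Real.exp_add (-A), Real.exp_add (-B)] at h
    refine le_trans (le_of_eq ?_) (mul_le_mul_of_nonneg_left h (Real.exp_pos _).le)
    rw [← Real.exp_add, inner_add_left, real_inner_smul_left, real_inner_smul_left]
    ring_nf
  have hi1 := ((hfin x).const_mul (Real.exp (-A))).const_mul a
  have hi2 := ((hfin y).const_mul (Real.exp (-B))).const_mul b
  have h2 := integral_mono (hfin _) ((hi1.add hi2).const_mul (Real.exp (a * A + b * B))) hpt
  simp only [Pi.add_apply] at h2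
  rw [integral_const_mul, integral_add hi1 hi2, integral_const_mul, integral_const_mul,
    integral_const_mul, integral_const_mul, ← exp_logMGF hfin x, ← exp_logMGF hfin y, ← hA, ← hB,
    ← Real.exp_add, ← Real.exp_add] at h2
  simpa [hab] using h2

/-- After tilting P by ⟨l, Y⟩, the variable ⟨e, Y⟩ has an everywhere finite, hence differentiable,
mgf. -/
lemma differentiable_logMGF_line
    (hfin : ∀ l : V, Integrable (fun ω => Real.exp (inner ℝ l (Y ω))) P) (l e : V) :
    Differentiable ℝ (fun t : ℝ => logMGF Y P (l + t • e)) := by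
  have hpos : 0 < ∫ ω, Real.exp (inner ℝ l (Y ω)) ∂P := integral_exp_pos (hfin l)
  have hset : integrableExpSet (fun ω => inner ℝ e (Y ω)) (P.tilted fun ω => inner ℝ l (Y ω)) =
      Set.univ := by
    refine Set.eq_univ_of_forall fun t => ?_
    refine (integrable_tilted_iff (hfin l) _).2 ?_
    refine (hfin (l + t • e)).congr (Eventually.of_forall fun ω => ?_)
    simp [inner_add_left, real_inner_smul_left, Real.exp_add]
  have heq : (fun t : ℝ => logMGF Y P (l + t • e)) = fun t => Real.log
      (mgf (fun ω => inner ℝ e (Y ω)) (P.tilted fun ω => inner ℝ l (Y ω)) t *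
        ∫ ω, Real.exp (inner ℝ l (Y ω)) ∂P) := by
    funext t
    rw [mgf, integral_exp_tilted, div_mul_cancel₀ _ hpos.ne', logMGF]
    simp [inner_add_left, real_inner_smul_left]
  rw [heq]
  intro t
  have := isProbabilityMeasure_tilted (hfin l)
  have ht : Integrable (fun ω => Real.exp (t * inner ℝ e (Y ω)))
      (P.tilted fun ω => inner ℝ l (Y ω)) := by
    have : t ∈ integrableExpSet (fun ω => inner ℝ e (Y ω))
      (P.tilted fun ω => inner ℝ l (Y ω)) := by rw [hset]; trivial
    exact this
  refine DifferentiableAt.log ((differentiableAt_mgf ?_).mul_const _) ?_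
  · rw [hset]; simp
  · exact (mul_pos (mgf_pos ht) hpos).ne'

end LogMGF

/-! ### Gaussian averages -/

section GaussianAverage

variable {V : Type*} [NormedAddCommGroup V] [InnerProductSpace ℝ V] {L : V → ℝ}

lemma gaussianAverage_zero (h0 : L 0 = 0) : gaussianAverage L 0 = 0 := by
  simp [gaussianAverage, h0]

lemma gaussianAverage_neg (L : V → ℝ) (l : V) : gaussianAverage L (-l) = gaussianAverage L l := by
  have h := gaussianReal_map_neg (μ := 0) (v := 1)
  rw [neg_zero] at h
  unfold gaussianAverage
  conv_rhs => rw [← h]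
  rw [MeasurableEmbedding.integral_map (f := fun x : ℝ => -x)
    (MeasurableEquiv.neg ℝ).measurableEmbedding]
  simp

lemma convexOn_gaussianAverage (hL : ConvexOn ℝ Set.univ L)
    (hint : ∀ l : V, Integrable (fun z : ℝ => L (z • l)) (gaussianReal 0 1)) :
    ConvexOn ℝ Set.univ (gaussianAverage L) := by
  refine ⟨convex_univ, fun x _ y _ a b ha hb hab => ?_⟩
  simp only [gaussianAverage, smul_eq_mul]
  rw [← integral_const_mul, ← integral_const_mul,
    ← integral_add ((hint x).const_mul a) ((hint y).const_mul b)]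
  refine integral_mono (hint _) (((hint x).const_mul a).add ((hint y).const_mul b)) fun z => ?_
  have := hL.2 (Set.mem_univ (z • x)) (Set.mem_univ (z • y)) ha hb hab
  rw [smul_comm a z x, smul_comm b z y, ← smul_add] at this
  exact this

/-- The average is even and convex, so its minimum is at 0, although L itself may take negative
values. -/
lemma gaussianAverage_nonneg (hL : ConvexOn ℝ Set.univ L) (h0 : L 0 = 0)
    (hint : ∀ l : V, Integrable (fun z : ℝ => L (z • l)) (gaussianReal 0 1)) (l : V) :
    0 ≤ gaussianAverage L l := by
  have h := (convexOn_gaussianAverage hL hint).2 (Set.mem_univ l) (Set.mem_univ (-l))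
    (by norm_num : (0 : ℝ) ≤ 1 / 2) (by norm_num : (0 : ℝ) ≤ 1 / 2) (by norm_num)
  rw [smul_neg, add_neg_cancel, gaussianAverage_zero h0, gaussianAverage_neg] at h
  simp only [smul_eq_mul] at h
  linarith

lemma differentiableAt_gaussianAverage_line [FiniteDimensional ℝ V]
    (hL : ConvexOn ℝ Set.univ L)
    (hd : ∀ l e : V, Differentiable ℝ (fun t : ℝ => L (l + t • e)))
    (hint : ∀ l : V, Integrable (fun z : ℝ => L (z • l)) (gaussianReal 0 1)) (l e : V) :
    DifferentiableAt ℝ (fun t : ℝ => gaussianAverage L (l + t • e)) 0 := by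
  have hLc := continuous_of_convexOn_univ hL
  let F : ℝ → ℝ → ℝ := fun z t => L (z • (l + t • e))
  have hF : ∀ z, F z = fun t => L (z • l + t • (z • e)) := by
    intro z; funext t; simp only [F, smul_add, smul_comm z t]
  have hFd : ∀ z, Differentiable ℝ (F z) := fun z => by rw [hF]; exact hd _ _
  have hFc : ∀ z, ConvexOn ℝ Set.univ (F z) := by
    intro z
    rw [hF]
    refine ⟨convex_univ, fun x _ y _ a b ha hb hab => ?_⟩
    have := hL.2 (Set.mem_univ (z • l + x • (z • e))) (Set.mem_univ (z • l + y • (z • e)))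
      ha hb hab
    refine le_trans (le_of_eq ?_) this
    obtain rfl : b = 1 - a := by linarith
    simp only [smul_eq_mul]
    congr 1
    module
  have key := hasDerivAt_integral_of_dominated_loc_of_deriv_le (μ := gaussianReal 0 1)
    (F := fun t z => F z t) (F' := fun t z => deriv (F z) t) (x₀ := (0 : ℝ))
    (s := Set.Ioo (-1) 1)
    (bound := fun z => |F z 2 - F z 1| + |F z (-1) - F z (-2)|)
    (Ioo_mem_nhds (by norm_num) (by norm_num))
    (Eventually.of_forall fun t => (hint (l + t • e)).aestronglyMeasurable)
    (hint _)
    ?_ (Eventually.of_forall fun z t ht => abs_deriv_le_of_convexOn (hFc z) (hFd z) ht)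
    ((((hint _).sub (hint _)).abs).add (((hint _).sub (hint _)).abs))
    (Eventually.of_forall fun z t _ => (hFd z t).hasDerivAt)
  · exact key.2.differentiableAt
  · have hm := measurable_deriv_with_param (f := F) (by
      simp only [F]; fun_prop)
    exact (hm.comp (measurable_id.prodMk measurable_const)).aestronglyMeasurable

end GaussianAverage

/-! ### Fourth moments of sums of independent random variables -/

section FourthMoment

variable {Ω : Type*} [MeasurableSpace Ω] {P : Measure Ω} [IsProbabilityMeasure P]

lemma integrable_pow_of_integrable_pow_four {Y : Ω → ℝ} (hY : AEStronglyMeasurable Y P)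
    (h4 : Integrable (fun ω => Y ω ^ 4) P) {k : ℕ} (hk : k ≤ 4) :
    Integrable (fun ω => Y ω ^ k) P := by
  refine Integrable.mono' ((integrable_const (1 : ℝ)).add h4) (hY.pow k)
    (Eventually.of_forall fun ω => ?_)
  simp only [Pi.add_apply, norm_pow, Real.norm_eq_abs]
  rw [← Even.pow_abs (by decide : Even 4)]
  rcases le_total |Y ω| 1 with h | h
  · exact (pow_le_one₀ (abs_nonneg _) h).trans (le_add_of_nonneg_right (by positivity))
  · exact (pow_le_pow_right₀ h hk).trans (le_add_of_nonneg_left zero_le_one)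

lemma integral_sum_pow_four_le {Y : ℕ → Ω → ℝ} (hY : ∀ i, Measurable (Y i)) (hind : iIndepFun Y P)
    (h4 : ∀ i, Integrable (fun ω => Y i ω ^ 4) P) (h0 : ∀ i, ∫ ω, Y i ω ∂P = 0) {K : ℝ}
    (hK1 : 1 ≤ K) (hK2 : ∀ i, ∫ ω, Y i ω ^ 2 ∂P ≤ K) (hK4 : ∀ i, ∫ ω, Y i ω ^ 4 ∂P ≤ K) (n : ℕ) :
    Integrable (fun ω => (∑ i ∈ Finset.range n, Y i ω) ^ 4) P ∧
      ∫ ω, (∑ i ∈ Finset.range n, Y i ω) ^ 4 ∂P ≤ 3 * (n : ℝ) ^ 2 * K ^ 2 := by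
  -- The induction also carries the mean and second moment. Terms with a first power vanish, leaving
  -- S⁴ + 6S²Y² + Y⁴, and 3n²K² + 6nK² + K ≤ 3(n+1)²K² since K ≥ 1.
  suffices H : Integrable (fun ω => (∑ i ∈ Finset.range n, Y i ω) ^ 4) P ∧
      ∫ ω, ∑ i ∈ Finset.range n, Y i ω ∂P = 0 ∧
      ∫ ω, (∑ i ∈ Finset.range n, Y i ω) ^ 2 ∂P ≤ n * K ∧
      ∫ ω, (∑ i ∈ Finset.range n, Y i ω) ^ 4 ∂P ≤ 3 * (n : ℝ) ^ 2 * K ^ 2 from ⟨H.1, H.2.2.2⟩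
  induction n with
  | zero => simp
  | succ n ih =>
    obtain ⟨i4, e1, e2, e4⟩ := ih
    set S : Ω → ℝ := fun ω => ∑ i ∈ Finset.range n, Y i ω with hS
    have hSm : Measurable S := by fun_prop
    have hSY : IndepFun S (Y n) P := by
      have := hind.indepFun_sum_range_succ hY n
      convert this using 1
      ext ω; simp [hS]
    have hSk : ∀ {k}, k ≤ 4 → Integrable (fun ω => S ω ^ k) P := fun hk =>
      integrable_pow_of_integrable_pow_four hSm.aestronglyMeasurable i4 hk
    have hYk : ∀ {k}, k ≤ 4 → Integrable (fun ω => Y n ω ^ k) P := fun hk =>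
      integrable_pow_of_integrable_pow_four (hY n).aestronglyMeasurable (h4 n) hk
    have hind' : ∀ j k : ℕ, IndepFun (fun ω => S ω ^ j) (fun ω => Y n ω ^ k) P := fun j k =>
      hSY.comp (φ := fun x : ℝ => x ^ j) (ψ := fun x : ℝ => x ^ k) (by fun_prop) (by fun_prop)
    have hprod : ∀ {j k : ℕ}, j ≤ 4 → k ≤ 4 → Integrable (fun ω => S ω ^ j * Y n ω ^ k) P :=
      fun hj hk => (hind' _ _).integrable_mul (hSk hj) (hYk hk)
    have hE : ∀ {j k : ℕ}, j ≤ 4 → k ≤ 4 → ∫ ω, S ω ^ j * Y n ω ^ k ∂P =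
        (∫ ω, S ω ^ j ∂P) * ∫ ω, Y n ω ^ k ∂P := fun hj hk =>
      (hind' _ _).integral_fun_mul_eq_mul_integral (hSk hj).aestronglyMeasurable
        (hYk hk).aestronglyMeasurable
    have hS1 : Integrable S P := by simpa using hSk (k := 1) (by norm_num)
    have hY1 : Integrable (Y n) P := by simpa using hYk (k := 1) (by norm_num)
    have hx2 : ∀ ω, (S ω + Y n ω) ^ 2 = S ω ^ 2 + 2 * (S ω ^ 1 * Y n ω ^ 1) + Y n ω ^ 2 :=
      fun ω => by ring
    have hx4 : ∀ ω, (S ω + Y n ω) ^ 4 = S ω ^ 4 + 4 * (S ω ^ 3 * Y n ω ^ 1) +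
        6 * (S ω ^ 2 * Y n ω ^ 2) + 4 * (S ω ^ 1 * Y n ω ^ 3) + Y n ω ^ 4 := fun ω => by ring
    have j4 := hSk (k := 4) le_rfl
    have j31 := (hprod (j := 3) (k := 1) (by norm_num) (by norm_num)).const_mul 4
    have j22 := (hprod (j := 2) (k := 2) (by norm_num) (by norm_num)).const_mul 6
    have j13 := (hprod (j := 1) (k := 3) (by norm_num) (by norm_num)).const_mul 4
    have j11 := (hprod (j := 1) (k := 1) (by norm_num) (by norm_num)).const_mul 2
    have j2 := hSk (k := 2) (by norm_num)
    have y2 := hYk (k := 2) (by norm_num)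
    have y4 := hYk (k := 4) le_rfl
    have y0 : ∫ ω, Y n ω ^ 1 ∂P = 0 := by simpa using h0 n
    have s0 : ∫ ω, S ω ^ 1 ∂P = 0 := by simpa using e1
    have n2 : 0 ≤ ∫ ω, Y n ω ^ 2 ∂P := integral_nonneg fun ω => by positivity
    have a2 : Integrable (fun ω => S ω ^ 2 + 2 * (S ω ^ 1 * Y n ω ^ 1)) P := j2.add j11
    have a4 : Integrable (fun ω => S ω ^ 4 + 4 * (S ω ^ 3 * Y n ω ^ 1)) P := j4.add j31
    have b4 : Integrable (fun ω => S ω ^ 4 + 4 * (S ω ^ 3 * Y n ω ^ 1) +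
        6 * (S ω ^ 2 * Y n ω ^ 2)) P := a4.add j22
    have c4 : Integrable (fun ω => S ω ^ 4 + 4 * (S ω ^ 3 * Y n ω ^ 1) +
        6 * (S ω ^ 2 * Y n ω ^ 2) + 4 * (S ω ^ 1 * Y n ω ^ 3)) P := b4.add j13
    simp only [Finset.sum_range_succ]
    refine ⟨?_, ?_, ?_, ?_⟩
    · exact (c4.add y4).congr (Eventually.of_forall fun ω => (hx4 ω).symm)
    · rw [integral_add hS1 hY1, e1, h0 n, add_zero]
    · rw [integral_congr_ae (Eventually.of_forall hx2), integral_add a2 y2,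
        integral_add j2 j11, integral_const_mul, hE (by norm_num) (by norm_num), s0]
      push_cast
      have := hK2 n
      linarith
    · rw [integral_congr_ae (Eventually.of_forall hx4),
        integral_add c4 y4, integral_add b4 j13, integral_add a4 j22,
        integral_add j4 j31, integral_const_mul, integral_const_mul, integral_const_mul,
        hE (by norm_num) (by norm_num), hE (by norm_num) (by norm_num),
        hE (by norm_num) (by norm_num), s0, y0]
      have h5 : (∫ ω, S ω ^ 2 ∂P) * ∫ ω, Y n ω ^ 2 ∂P ≤ (n * K) * K :=
        mul_le_mul e2 (hK2 n) n2 (by positivity)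
      have := hK4 n
      push_cast
      nlinarith

/-- Complete convergence in the law of large numbers, under a fourth moment. -/
lemma tsum_measure_mean_ne_top {γ : Measure ℝ} [IsProbabilityMeasure γ] {h : ℝ → ℝ}
    (hm : Measurable h) (h4 : Integrable (fun z => h z ^ 4) γ) {ε : ℝ} (hε : 0 < ε) :
    ∑' n : ℕ, Measure.infinitePi (fun _ : ℕ => γ)
      {x | ε ≤ |(∑ i ∈ Finset.range (n + 1), h (x i)) / ((n : ℝ) + 1) - ∫ z, h z ∂γ|} ≠ ⊤ := by
  set Q := Measure.infinitePi (fun _ : ℕ => γ)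
  set m := ∫ z, h z ∂γ with hmdef
  let k : ℝ → ℝ := fun z => h z - m
  have hk : Measurable k := hm.sub_const m
  have hh1 : Integrable h γ := by
    simpa using integrable_pow_of_integrable_pow_four hm.aestronglyMeasurable h4
      (k := 1) (by norm_num)
  have hk4 : Integrable (fun z => k z ^ 4) γ := by
    -- (h - m)⁴ ≤ 8(h⁴ + m⁴).
    refine Integrable.mono' ((h4.add (integrable_const (m ^ 4))).const_mul 8)
      (by fun_prop) (Eventually.of_forall fun z => ?_)
    rw [Real.norm_of_nonneg (by positivity)]
    simp only [k, Pi.add_apply]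
    nlinarith [sq_nonneg (h z + m), sq_nonneg (h z - m), sq_nonneg (h z ^ 2 - m ^ 2),
      sq_nonneg ((h z + m) ^ 2), mul_nonneg (sq_nonneg (h z + m)) (sq_nonneg (h z - m)),
      sq_nonneg ((h z + m) ^ 2 - (h z - m) ^ 2)]
  have hk2 : Integrable (fun z => k z ^ 2) γ :=
    integrable_pow_of_integrable_pow_four hk.aestronglyMeasurable hk4 (by norm_num)
  have hmap : ∀ i : ℕ, Q.map (fun x => x i) = γ := fun i =>
    Measure.infinitePi_map_eval (fun _ : ℕ => γ) i
  have hInt : ∀ (i : ℕ) {u : ℝ → ℝ}, Integrable u γ → Integrable (fun x : ℕ → ℝ => u (x i)) Q := by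
    intro i u hu
    rw [← hmap i] at hu
    exact hu.comp_measurable (measurable_pi_apply i)
  have hEq : ∀ (i : ℕ) {u : ℝ → ℝ}, Integrable u γ → ∫ x, u (x i) ∂Q = ∫ z, u z ∂γ := by
    intro i u hu
    have hu' := hu.aestronglyMeasurable
    rw [← hmap i] at hu'
    conv_rhs => rw [← hmap i]
    exact (integral_map (measurable_pi_apply i).aemeasurable hu').symm
  set K := 1 + ∫ z, k z ^ 2 ∂γ + ∫ z, k z ^ 4 ∂γ with hK
  have e2 : 0 ≤ ∫ z, k z ^ 2 ∂γ := integral_nonneg fun z => by positivity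
  have e4 : 0 ≤ ∫ z, k z ^ 4 ∂γ := integral_nonneg fun z => by positivity
  have key := fun n => integral_sum_pow_four_le (P := Q) (Y := fun i x => k (x i))
    (fun i => hk.comp (measurable_pi_apply i))
    (iIndepFun_infinitePi (P := fun _ : ℕ => γ) (X := fun _ => k) (fun _ => hk))
    (fun i => hInt i hk4)
    (fun i => by
      rw [hEq i (u := k) (hh1.sub (integrable_const m))]
      simp only [k]
      rw [integral_sub hh1 (integrable_const m)]
      simp [hmdef])
    (K := K) (by linarith) (fun i => by rw [hEq i hk2]; linarith)
    (fun i => by rw [hEq i hk4]; linarith) n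
  -- Markov's inequality for the fourth power: O(n²) against (ε(n+1))⁴.
  have hbound : ∀ n : ℕ, Q {x | ε ≤ |(∑ i ∈ Finset.range (n + 1), h (x i)) / ((n : ℝ) + 1) - m|} ≤
      ENNReal.ofReal (3 * K ^ 2 / ε ^ 4 * (1 / ((n : ℝ) + 1) ^ 2)) := by
    intro n
    have hn : (0 : ℝ) < n + 1 := by positivity
    have hsum : ∀ x : ℕ → ℝ, ∑ i ∈ Finset.range (n + 1), k (x i) =
        ((n : ℝ) + 1) * ((∑ i ∈ Finset.range (n + 1), h (x i)) / ((n : ℝ) + 1) - m) := by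
      intro x
      simp only [k, Finset.sum_sub_distrib, Finset.sum_const, Finset.card_range, nsmul_eq_mul]
      field_simp
      push_cast
      ring
    have h1 := mul_meas_ge_le_integral_of_nonneg
      (Eventually.of_forall fun x => by positivity) (key (n + 1)).1 ((ε * (n + 1)) ^ 4)
    have h2 := h1.trans (key (n + 1)).2
    rw [← ofReal_measureReal (measure_ne_top _ _)]
    refine ENNReal.ofReal_le_ofReal ?_
    have hsub : {x : ℕ → ℝ | ε ≤ |(∑ i ∈ Finset.range (n + 1), h (x i)) / ((n : ℝ) + 1) - m|} ⊆
        {x | (ε * (n + 1)) ^ 4 ≤ (∑ i ∈ Finset.range (n + 1), k (x i)) ^ 4} := by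
      intro x hx
      simp only [Set.mem_ofPred_eq] at hx ⊢
      rw [← Even.pow_abs (by decide : Even 4) (∑ i ∈ Finset.range (n + 1), k (x i)), hsum, abs_mul,
        abs_of_pos hn, mul_comm ε]
      gcongr
    refine (measureReal_mono hsub (measure_ne_top _ _)).trans ?_
    push_cast at h2
    rw [← le_div_iff₀' (by positivity)] at h2
    refine h2.trans (le_of_eq ?_)
    field_simp
  refine ne_top_of_le_ne_top ?_ (ENNReal.tsum_le_tsum hbound)
  have hs : Summable fun n : ℕ => 3 * K ^ 2 / ε ^ 4 * (1 / ((n : ℝ) + 1) ^ 2) := by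
    refine Summable.mul_left _ ?_
    have := (summable_nat_add_iff 1).2 (Real.summable_one_div_nat_pow.2 one_lt_two)
    simpa using this
  rw [← ENNReal.ofReal_tsum_of_nonneg (fun n => by positivity) hs]
  exact ENNReal.ofReal_ne_top

end FourthMoment

/-! ### Growth of convex functions integrable against Gaussian measures -/

section Growth

lemma exp_le_gaussianReal_Icc {x : ℝ} (hx : 0 ≤ x) :
    (Real.sqrt (2 * Real.pi))⁻¹ * Real.exp (-(x ^ 2 + 1)) ≤
      (gaussianReal 0 1).real (Set.Icc x (x + 1)) := by
  set c := (Real.sqrt (2 * Real.pi))⁻¹ * Real.exp (-(x ^ 2 + 1)) with hc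
  have hc0 : 0 ≤ c := by positivity
  have h : ENNReal.ofReal c ≤ gaussianReal 0 1 (Set.Icc x (x + 1)) := by
    rw [gaussianReal_apply 0 one_ne_zero]
    calc ENNReal.ofReal c = ∫⁻ _ in Set.Icc x (x + 1), ENNReal.ofReal c := by simp
      _ ≤ _ := by
        refine setLIntegral_mono' measurableSet_Icc fun w hw => ?_
        rw [gaussianPDF]
        refine ENNReal.ofReal_le_ofReal ?_
        simp only [gaussianPDFReal, NNReal.coe_one, mul_one, sub_zero, hc]
        refine mul_le_mul_of_nonneg_left (Real.exp_le_exp.2 ?_) (by positivity)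
        have h1 : w ^ 2 ≤ (x + 1) ^ 2 := pow_le_pow_left₀ (hx.trans hw.1) hw.2 2
        -- (x + 1)²/2 ≤ x² + 1.
        nlinarith [sq_nonneg (x - 1)]
  rw [measureReal_def]
  exact (ENNReal.ofReal_le_iff_le_toReal (measure_ne_top _ _)).1 h

/-- G is nondecreasing on [0, ∞), so G z times the Gaussian mass of [z/s, z/s + 1] is at most the
integral of G(s ·). Large s gives slow growth. -/
lemma exists_bound_of_convexOn_nonneg {G : ℝ → ℝ} (hG : ConvexOn ℝ Set.univ G) (h0 : G 0 = 0)
    (hnn : ∀ z, 0 ≤ G z) {s : ℝ} (hs : 0 < s)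
    (hint : Integrable (fun z => G (s * z)) (gaussianReal 0 1)) :
    ∃ K : ℝ, ∀ z, 0 ≤ z → G z ≤ K * Real.exp ((z / s) ^ 2) := by
  set C := ∫ z, G (s * z) ∂(gaussianReal 0 1)
  refine ⟨C * Real.sqrt (2 * Real.pi) * Real.exp 1, fun z hz => ?_⟩
  have hmono : ∀ w ∈ Set.Icc (z / s) (z / s + 1), G z ≤ G (s * w) := by
    intro w hw
    have hzw : z ≤ s * w := by have := hw.1; rwa [div_le_iff₀' hs] at this
    rcases hz.eq_or_lt with rfl | hz
    · rw [h0]; exact hnn _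
    have hsw : 0 < s * w := hz.trans_le hzw
    have hθ : z / (s * w) ≤ 1 := (div_le_one hsw).2 hzw
    have h := hG.2 (Set.mem_univ (s * w)) (Set.mem_univ 0) (by positivity : 0 ≤ z / (s * w))
      (sub_nonneg.2 hθ) (by ring)
    simp only [smul_eq_mul, h0, mul_zero, add_zero, div_mul_cancel₀ z hsw.ne'] at h
    exact h.trans (mul_le_of_le_one_left (hnn _) hθ)
  have h1 : G z * (gaussianReal 0 1).real (Set.Icc (z / s) (z / s + 1)) ≤ C := by
    calc G z * (gaussianReal 0 1).real (Set.Icc (z / s) (z / s + 1))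
        = ∫ _ in Set.Icc (z / s) (z / s + 1), G z ∂(gaussianReal 0 1) := by
          rw [setIntegral_const, smul_eq_mul, mul_comm]
      _ ≤ ∫ w in Set.Icc (z / s) (z / s + 1), G (s * w) ∂(gaussianReal 0 1) :=
          setIntegral_mono_on (integrableOn_const (measure_ne_top _ _)) hint.integrableOn
            measurableSet_Icc hmono
      _ ≤ C := setIntegral_le_integral hint (Eventually.of_forall fun w => hnn _)
  have h2 := (mul_le_mul_of_nonneg_left (exp_le_gaussianReal_Icc (by positivity : 0 ≤ z / s))
    (hnn z)).trans h1
  have hpi : 0 < Real.sqrt (2 * Real.pi) := by positivity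
  calc G z = G z * ((Real.sqrt (2 * Real.pi))⁻¹ * Real.exp (-((z / s) ^ 2 + 1))) *
        (Real.sqrt (2 * Real.pi) * Real.exp ((z / s) ^ 2 + 1)) := by
        rw [Real.exp_neg]; field_simp
    _ ≤ C * (Real.sqrt (2 * Real.pi) * Real.exp ((z / s) ^ 2 + 1)) := by gcongr
    _ = _ := by rw [Real.exp_add]; ring

/-- A convex function all of whose dilations are Gaussian integrable grows more slowly than every
`exp (c * z ^ 2)`. -/
lemma exists_abs_le_mul_exp_sq {F : ℝ → ℝ} (hF : ConvexOn ℝ Set.univ F)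
    (hd : DifferentiableAt ℝ F 0)
    (hint : ∀ s : ℝ, Integrable (fun z => F (s * z)) (gaussianReal 0 1)) {c : ℝ} (hc : 0 < c) :
    ∃ K : ℝ, ∀ z, |F z| ≤ K * Real.exp (c * z ^ 2) := by
  -- Subtracting the tangent at 0 leaves a nonnegative convex function vanishing at 0; the negative
  -- half-line is treated by reflection.
  set m := deriv F 0
  let G : ℝ → ℝ := fun z => F z - F 0 - m * z
  have hG : ConvexOn ℝ Set.univ G := by
    refine ⟨convex_univ, fun x _ y _ a b ha hb hab => ?_⟩
    have := hF.2 (Set.mem_univ x) (Set.mem_univ y) ha hb hab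
    obtain rfl : b = 1 - a := by linarith
    simp only [smul_eq_mul, G] at this ⊢
    linarith
  have hG0 : G 0 = 0 := by simp [G]
  have hnn : ∀ z, 0 ≤ G z := by
    intro z
    rcases lt_trichotomy z 0 with hz | rfl | hz
    · have h := hF.slope_le_deriv (Set.mem_univ z) (Set.mem_univ 0) hz hd
      rw [slope_def_field, div_le_iff₀ (by linarith)] at h
      simp only [G]; linarith
    · exact hG0.ge
    · have h := hF.deriv_le_slope (Set.mem_univ 0) (Set.mem_univ z) hz hd
      rw [slope_def_field, le_div_iff₀ (by linarith)] at h
      simp only [G]; linarith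
  have hid : Integrable (fun z : ℝ => z) (gaussianReal 0 1) :=
    (memLp_id_gaussianReal 1).integrable le_rfl
  have hGint : ∀ s, Integrable (fun z => G (s * z)) (gaussianReal 0 1) := fun s =>
    ((hint s).sub (integrable_const _)).sub ((hid.const_mul s).const_mul m)
  have hGneg : ConvexOn ℝ Set.univ (fun z => G (-z)) := by
    refine ⟨convex_univ, fun x _ y _ a b ha hb hab => ?_⟩
    have := hG.2 (Set.mem_univ (-x)) (Set.mem_univ (-y)) ha hb hab
    simp only [smul_eq_mul] at this ⊢
    rwa [mul_neg, mul_neg, ← neg_add] at this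
  set s := (Real.sqrt c)⁻¹ with hs
  have hs0 : 0 < s := by positivity
  have hsz : ∀ z : ℝ, (z / s) ^ 2 = c * z ^ 2 := by
    intro z
    rw [hs, div_inv_eq_mul, mul_pow, Real.sq_sqrt hc.le, mul_comm]
  obtain ⟨K₁, h₁⟩ := exists_bound_of_convexOn_nonneg hG hG0 hnn hs0 (hGint s)
  obtain ⟨K₂, h₂⟩ := exists_bound_of_convexOn_nonneg hGneg (by simpa using hG0)
    (fun z => hnn _) hs0 (by simpa using hGint (-s))
  refine ⟨|K₁| + |K₂| + |F 0| + |m| * (1 + 1 / c), fun z => ?_⟩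
  set E := Real.exp (c * z ^ 2) with hE
  have hE1 : 1 + c * z ^ 2 ≤ E := by rw [hE, add_comm]; exact Real.add_one_le_exp _
  have hE0 : 1 ≤ E := by nlinarith [sq_nonneg z]
  have hGz : G z ≤ (|K₁| + |K₂|) * E := by
    rcases le_total 0 z with hz | hz
    · have := h₁ z hz
      rw [hsz] at this
      nlinarith [le_abs_self K₁, abs_nonneg K₂]
    · have := h₂ (-z) (by linarith)
      rw [hsz, neg_sq, neg_neg] at this
      nlinarith [le_abs_self K₂, abs_nonneg K₁]
  have hz : |z| ≤ (1 + 1 / c) * E := by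
    have h1 : |z| ≤ 1 + z ^ 2 := by nlinarith [sq_nonneg (|z| - 1), sq_abs z, abs_nonneg z]
    have h2 : 1 + z ^ 2 ≤ (1 + 1 / c) * (1 + c * z ^ 2) := by
      have : (1 + 1 / c) * (1 + c * z ^ 2) = 1 + z ^ 2 + (1 / c + c * z ^ 2) := by
        field_simp; ring
      rw [this]
      exact le_add_of_nonneg_right (by positivity)
    exact (h1.trans h2).trans (mul_le_mul_of_nonneg_left hE1 (by positivity))
  calc |F z| = |G z + F 0 + m * z| := by simp only [G]; ring_nf
    _ ≤ |G z| + |F 0| + |m| * |z| := by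
      rw [← abs_mul]; exact abs_add_three _ _ _
    _ ≤ (|K₁| + |K₂|) * E + |F 0| * E + |m| * ((1 + 1 / c) * E) := by
      rw [abs_of_nonneg (hnn z)]
      gcongr
      exact le_mul_of_one_le_right (abs_nonneg _) hE0
    _ = _ := by ring

lemma integrable_pow_four_of_convexOn {F : ℝ → ℝ} (hF : ConvexOn ℝ Set.univ F)
    (hd : DifferentiableAt ℝ F 0)
    (hint : ∀ s : ℝ, Integrable (fun z => F (s * z)) (gaussianReal 0 1)) :
    Integrable (fun z => F z ^ 4) (gaussianReal 0 1) := by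
  -- Fernique's theorem; growth at rate C/4 becomes rate C after the fourth power.
  obtain ⟨C, hC, hCi⟩ := IsGaussian.exists_integrable_exp_sq (gaussianReal 0 1)
  obtain ⟨K, hK⟩ := exists_abs_le_mul_exp_sq hF hd hint (c := C / 4) (by positivity)
  refine Integrable.mono' (hCi.const_mul (K ^ 4))
    ((continuous_of_convexOn_univ hF).pow 4).aestronglyMeasurable
    (Eventually.of_forall fun z => ?_)
  rw [norm_pow, Real.norm_eq_abs]
  refine (pow_le_pow_left₀ (abs_nonneg _) (hK z) 4).trans (le_of_eq ?_)
  rw [mul_pow, ← Real.exp_nat_mul, Real.norm_eq_abs, sq_abs]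
  push_cast
  ring_nf

end Growth

/-! ### The direction of a Gaussian vector is uniform on the sphere -/

section Sphere

/-- The direction of a random vector with a radial density is uniformly distributed. -/
lemma withDensity_norm_direction {E : Type*} [NormedAddCommGroup E] [NormedSpace ℝ E]
    [MeasurableSpace E] [BorelSpace E] [FiniteDimensional ℝ E] [Nontrivial E] (μ : Measure E)
    [μ.IsAddHaarMeasure] {ρ : ℝ → ENNReal} (hρ : Measurable ρ)
    (hprob : μ.withDensity (fun x => ρ ‖x‖) Set.univ = 1) {A : Set E} (hA : MeasurableSet A) :
    μ.withDensity (fun x => ρ ‖x‖) {x | ‖x‖⁻¹ • x ∈ A} =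
      (μ.toSphere Set.univ)⁻¹ * μ.toSphere (Subtype.val ⁻¹' A) := by
  have hdir : Measurable fun x : E => ‖x‖⁻¹ • x := by fun_prop
  -- In polar coordinates the integral splits into a spherical and a radial factor; B = univ
  -- identifies the radial one.
  have key : ∀ B : Set E, MeasurableSet B → μ.withDensity (fun x => ρ ‖x‖) {x | ‖x‖⁻¹ • x ∈ B} =
      μ.toSphere (Subtype.val ⁻¹' B) *
        ∫⁻ r : Set.Ioi (0 : ℝ), ρ r ∂(Measure.volumeIoiPow (Module.finrank ℝ E - 1)) := by
    intro B hB
    have hB' : MeasurableSet {x : E | ‖x‖⁻¹ • x ∈ B} := hdir hB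
    rw [withDensity_apply _ hB', ← lintegral_indicator hB']
    have h1 : ∫⁻ x, {x : E | ‖x‖⁻¹ • x ∈ B}.indicator (fun x => ρ ‖x‖) x ∂μ =
        ∫⁻ x : ({(0)}ᶜ : Set E), {x : E | ‖x‖⁻¹ • x ∈ B}.indicator (fun x => ρ ‖x‖) x
          ∂(μ.comap (↑)) := by
      rw [lintegral_subtype_comap (measurableSet_singleton _).compl
        ({x : E | ‖x‖⁻¹ • x ∈ B}.indicator fun x => ρ ‖x‖), restrict_compl_singleton]
    have h2 := μ.measurePreserving_homeomorphUnitSphereProd.lintegral_comp_emb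
      (Homeomorph.measurableEmbedding _)
      (fun p : Metric.sphere (0 : E) 1 × Set.Ioi (0 : ℝ) =>
        (Subtype.val ⁻¹' B : Set (Metric.sphere (0 : E) 1)).indicator (fun _ => (1 : ENNReal)) p.1 *
          ρ p.2)
    rw [h1]
    refine Eq.trans (lintegral_congr fun x => ?_) (h2.trans ?_)
    · have hx : ((homeomorphUnitSphereProd E x).1 : E) = ‖(x : E)‖⁻¹ • (x : E) := by simp
      by_cases h : ‖(x : E)‖⁻¹ • (x : E) ∈ B
      · rw [Set.indicator_of_mem (by exact h), Set.indicator_of_mem (by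
          rw [Set.mem_preimage, hx]; exact h)]
        simp
      · rw [Set.indicator_of_notMem (by exact h), Set.indicator_of_notMem (by
          rw [Set.mem_preimage, hx]; exact h)]
        simp
    · have hm : MeasurableSet (Subtype.val ⁻¹' B : Set (Metric.sphere (0 : E) 1)) :=
        measurable_subtype_coe hB
      rw [lintegral_prod_mul (f := (Subtype.val ⁻¹' B : Set (Metric.sphere (0 : E) 1)).indicator
        (fun _ => (1 : ENNReal))) (g := fun r : Set.Ioi (0 : ℝ) => ρ r)
        (measurable_const.indicator hm).aemeasurable (by fun_prop),
        lintegral_indicator_const hm, one_mul]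
  have huniv := key Set.univ MeasurableSet.univ
  simp only [Set.mem_univ, Set.preimage_univ] at huniv
  rw [Set.ofPred_true, hprob] at huniv
  rw [key A hA, mul_comm]
  congr 1
  refine ENNReal.eq_inv_of_mul_eq_one_left ?_
  rw [mul_comm]
  exact huniv.symm

lemma pi_gaussianReal_eq_withDensity (ι : Type*) [Fintype ι] :
    Measure.pi (fun _ : ι => gaussianReal 0 1) =
      (volume : Measure (ι → ℝ)).withDensity
        (fun x => ENNReal.ofReal (∏ i, gaussianPDFReal 0 1 (x i))) := by
  refine Measure.pi_eq fun s hs => ?_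
  rw [withDensity_apply _ (MeasurableSet.univ_pi hs), volume_pi, Measure.restrict_pi_pi,
    ← ofReal_integral_eq_lintegral_ofReal, integral_fintype_prod_eq_prod,
    ENNReal.ofReal_prod_of_nonneg]
  · refine Finset.prod_congr rfl fun i _ => ?_
    rw [gaussianReal_apply_eq_integral 0 one_ne_zero]
  · exact fun i _ => integral_nonneg fun x => gaussianPDFReal_nonneg 0 1 x
  · exact Integrable.fintype_prod fun i => (integrable_gaussianPDFReal 0 1).integrableOn
  · exact Eventually.of_forall fun x => Finset.prod_nonneg fun i _ => gaussianPDFReal_nonneg 0 1 _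

lemma map_toLp_pi_gaussianReal (ι : Type*) [Fintype ι] :
    (Measure.pi (fun _ : ι => gaussianReal 0 1)).map (WithLp.toLp 2) =
      (volume : Measure (EuclideanSpace ℝ ι)).withDensity (fun x => ENNReal.ofReal
        ((Real.sqrt (2 * Real.pi))⁻¹ ^ Fintype.card ι * Real.exp (-‖x‖ ^ 2 / 2))) := by
  have hvol := PiLp.volume_preserving_toLp ι
  have hm : Measurable fun x : EuclideanSpace ℝ ι => ENNReal.ofReal
        ((Real.sqrt (2 * Real.pi))⁻¹ ^ Fintype.card ι * Real.exp (-‖x‖ ^ 2 / 2)) := by fun_prop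
  ext B hB
  rw [Measure.map_apply hvol.measurable hB, pi_gaussianReal_eq_withDensity,
    withDensity_apply _ (hvol.measurable hB), withDensity_apply _ hB,
    ← hvol.setLIntegral_comp_preimage hB hm]
  refine lintegral_congr fun x => ?_
  congr 1
  simp only [gaussianPDFReal, NNReal.coe_one, mul_one, sub_zero]
  rw [Finset.prod_mul_distrib, Finset.prod_const, Finset.card_univ, ← Real.exp_sum,
    EuclideanSpace.norm_sq_eq]
  simp only [Real.norm_eq_abs, sq_abs, neg_div, Finset.sum_div, Finset.sum_neg_distrib]

/-- The first `n + 1` coordinates of a sequence, as a vector of Euclidean space. -/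
def initialVector (n : ℕ) (x : ℕ → ℝ) : EuclideanSpace ℝ (Fin (n + 1)) :=
  WithLp.toLp 2 fun i => x i

lemma measurable_initialVector (n : ℕ) : Measurable (initialVector n) :=
  (PiLp.volume_preserving_toLp (Fin (n + 1))).measurable.comp
    (measurable_pi_lambda _ fun _ => measurable_pi_apply _)

lemma norm_sq_initialVector (n : ℕ) (x : ℕ → ℝ) :
    ‖initialVector n x‖ ^ 2 = ∑ i ∈ Finset.range (n + 1), x i ^ 2 := by
  rw [EuclideanSpace.norm_sq_eq, ← Fin.sum_univ_eq_sum_range (fun i => x i ^ 2)]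
  simp [initialVector]

/-- One Gaussian sequence serves all rows, because only probabilities within a single row are ever
compared. -/
lemma uniformSphere_eq_gaussian (n : ℕ) {A : Set (EuclideanSpace ℝ (Fin (n + 1)))}
    (hA : MeasurableSet A) :
    uniformSphere n {θ | (θ : EuclideanSpace ℝ (Fin (n + 1))) ∈ A} =
      Measure.infinitePi (fun _ : ℕ => gaussianReal 0 1)
        {x | ‖initialVector n x‖⁻¹ • initialVector n x ∈ A} := by
  set Q := Measure.infinitePi (fun _ : ℕ => gaussianReal 0 1)
  have hpi : Q.map (fun x (i : Fin (n + 1)) => x i) =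
      Measure.pi fun _ : Fin (n + 1) => gaussianReal 0 1 := by
    have hind : iIndepFun (fun (i : ℕ) (x : ℕ → ℝ) => x i) Q :=
      iIndepFun_infinitePi (P := fun _ : ℕ => gaussianReal 0 1) (X := fun _ x => x)
        (fun _ => measurable_id)
    have := (iIndepFun_iff_map_fun_eq_pi_map (fun i => (measurable_pi_apply _).aemeasurable)).1
      (hind.precomp (g := fun i : Fin (n + 1) => (i : ℕ)) Fin.val_injective)
    rw [this]
    congr 1
    funext i
    exact Measure.infinitePi_map_eval (fun _ : ℕ => gaussianReal 0 1) i
  have hmap : Q.map (initialVector n) = (volume : Measure (EuclideanSpace ℝ (Fin (n + 1)))).withDensity (fun x => ENNReal.ofReal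
        ((Real.sqrt (2 * Real.pi))⁻¹ ^ Fintype.card (Fin (n + 1)) *
          Real.exp (-‖x‖ ^ 2 / 2))) := by
    rw [← map_toLp_pi_gaussianReal, ← hpi, Measure.map_map
      (PiLp.volume_preserving_toLp (Fin (n + 1))).measurable
      (measurable_pi_lambda _ fun _ => measurable_pi_apply _)]
    rfl
  have hdir : MeasurableSet {x : EuclideanSpace ℝ (Fin (n + 1)) | ‖x‖⁻¹ • x ∈ A} :=
    (by fun_prop : Measurable fun x : EuclideanSpace ℝ (Fin (n + 1)) => ‖x‖⁻¹ • x) hA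
  have hprob : IsProbabilityMeasure (Q.map (initialVector n)) :=
    Measure.isProbabilityMeasure_map (measurable_initialVector n).aemeasurable
  have h := withDensity_norm_direction (volume : Measure (EuclideanSpace ℝ (Fin (n + 1)))) (ρ := fun r => ENNReal.ofReal
        ((Real.sqrt (2 * Real.pi))⁻¹ ^ Fintype.card (Fin (n + 1)) * Real.exp (-r ^ 2 / 2)))
    (by fun_prop) (by rw [← hmap]; exact measure_univ) hA
  rw [← hmap, Measure.map_apply (measurable_initialVector n) hdir] at h
  exact h.symm

end Sphere

/-! ### Empirical averages of the weights -/

section EmpiricalAverage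

lemma convexOn_sum_div {E ι : Type*} [AddCommGroup E] [Module ℝ E] (s : Finset ι)
    {f : ι → E → ℝ} (hf : ∀ i ∈ s, ConvexOn ℝ Set.univ (f i)) {c : ℝ} (hc : 0 ≤ c) :
    ConvexOn ℝ Set.univ fun x => (∑ i ∈ s, f i x) / c := by
  refine ⟨convex_univ, fun x _ y _ a b ha hb hab => ?_⟩
  simp only [smul_eq_mul]
  rw [mul_div_assoc', mul_div_assoc', ← add_div, Finset.mul_sum, Finset.mul_sum,
    ← Finset.sum_add_distrib]
  gcongr with i hi
  exact (hf i hi).2 (Set.mem_univ x) (Set.mem_univ y) ha hb hab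

/-- Above, T s is at most the larger endpoint value. Below, 1 is the midpoint of s and 2 - s, so T s
≥ 2 T 1 - T (2 - s). -/
lemma abs_sub_le_of_convexOn {T : ℝ → ℝ} (hT : ConvexOn ℝ Set.univ T) {I η δ s : ℝ}
    (hl : |T (1 - δ) - I| ≤ 2 * η) (hm : |T 1 - I| ≤ η) (hr : |T (1 + δ) - I| ≤ 2 * η)
    (hs : |s - 1| ≤ δ) : |T s - I| ≤ 4 * η := by
  rw [abs_le] at *
  have hup : ∀ r, -δ ≤ r - 1 → r - 1 ≤ δ → T r ≤ I + 2 * η := by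
    intro r hr1 hr2
    refine (hT.le_max_of_mem_Icc (Set.mem_univ (1 - δ)) (Set.mem_univ (1 + δ))
      ⟨by linarith, by linarith⟩).trans (max_le ?_ ?_) <;> linarith
  have h1 := hup s hs.1 hs.2
  have h2 := hup (2 - s) (by linarith) (by linarith)
  have h3 := hT.2 (Set.mem_univ s) (Set.mem_univ (2 - s))
    (by norm_num : (0 : ℝ) ≤ 1 / 2) (by norm_num : (0 : ℝ) ≤ 1 / 2) (by norm_num)
  rw [show (1 / 2 : ℝ) • s + (1 / 2 : ℝ) • (2 - s) = 1 by simp only [smul_eq_mul]; ring] at h3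
  simp only [smul_eq_mul] at h3
  constructor <;> linarith

lemma integral_sq_gaussianReal : ∫ z : ℝ, z ^ 2 ∂(gaussianReal 0 1) = 1 := by
  rw [← variance_of_integral_eq_zero (X := fun z : ℝ => z) aemeasurable_id' (by simp)]
  simp [variance_fun_id_gaussianReal]

lemma integrable_sq_pow_four_gaussianReal :
    Integrable (fun z : ℝ => (z ^ 2) ^ 4) (gaussianReal 0 1) := by
  refine integrable_pow_four_of_convexOn (even_two.convexOn_pow) (by fun_prop) fun s => ?_
  simp_rw [mul_pow]
  exact ((memLp_id_gaussianReal 2).integrable_sq).const_mul _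

variable {F : ℝ → ℝ}

lemma tsum_measure_scaled_mean_ne_top (hF : ConvexOn ℝ Set.univ F) (hd : DifferentiableAt ℝ F 0)
    (hint : ∀ s : ℝ, Integrable (fun z => F (s * z)) (gaussianReal 0 1)) (s : ℝ) {ε : ℝ}
    (hε : 0 < ε) :
    ∑' n : ℕ, Measure.infinitePi (fun _ : ℕ => gaussianReal 0 1)
      {x | ε ≤ |(∑ i ∈ Finset.range (n + 1), F (s * x i)) / ((n : ℝ) + 1) -
        ∫ z, F (s * z) ∂(gaussianReal 0 1)|} ≠ ⊤ := by
  have hc := continuous_of_convexOn_univ hF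
  refine tsum_measure_mean_ne_top (h := fun z => F (s * z)) (by fun_prop) ?_ hε
  refine integrable_pow_four_of_convexOn (F := fun z => F (s * z)) ?_ ?_ fun t => ?_
  · exact hF.comp_linearMap (LinearMap.mulLeft ℝ s)
  · refine DifferentiableAt.comp (g := F) (f := fun z => s * z) (0 : ℝ) ?_ (by fun_prop)
    simpa using hd
  · simpa only [mul_assoc] using hint (s * t)

/-- The averages of a convex function over the rescaled weights differ from the Gaussian average
with summable probabilities. -/
lemma tsum_uniformSphere_ne_top (hF : ConvexOn ℝ Set.univ F) (hd : DifferentiableAt ℝ F 0)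
    (hint : ∀ s : ℝ, Integrable (fun z => F (s * z)) (gaussianReal 0 1)) {ε : ℝ} (hε : 0 < ε) :
    ∑' n : ℕ, uniformSphere n {θ | ε ≤ |(∑ i, F (Real.sqrt ((n : ℝ) + 1) * θ.1 i)) /
      ((n : ℝ) + 1) - ∫ z, F z ∂(gaussianReal 0 1)|} ≠ ⊤ := by
  set γ := gaussianReal 0 1
  set Q := Measure.infinitePi (fun _ : ℕ => γ)
  have hc := continuous_of_convexOn_univ hF
  let Ψ : ℝ → ℝ := fun s => ∫ z, F (s * z) ∂γ
  have hΨ1 : ∫ z, F z ∂γ = Ψ 1 := by simp [Ψ]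
  have hΨc : Continuous Ψ := by
    have h := continuous_of_convexOn_univ (convexOn_gaussianAverage hF (fun l => by
      simpa [mul_comm] using hint l))
    convert h using 1
    funext s
    simp [Ψ, γ, gaussianAverage, mul_comm]
  -- The final error is 4η = ε/2 < ε.
  set η := ε / 8 with hη
  have hη0 : 0 < η := by positivity
  obtain ⟨δ, hδ, hΨδ⟩ : ∃ δ > 0, ∀ s, |s - 1| ≤ δ → |Ψ s - Ψ 1| ≤ η := by
    obtain ⟨δ, hδ, h⟩ := Metric.continuous_iff.1 hΨc 1 η hη0
    refine ⟨δ / 2, by positivity, fun s hs => (h s ?_).le⟩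
    rw [Real.dist_eq]; linarith
  obtain ⟨τ, hτ, hsqrt⟩ : ∃ τ > 0, ∀ q : ℝ, |q - 1| < τ → |(Real.sqrt q)⁻¹ - 1| ≤ δ := by
    have hcont : ContinuousAt (fun q : ℝ => (Real.sqrt q)⁻¹) 1 :=
      Real.continuous_sqrt.continuousAt.inv₀ (by simp)
    obtain ⟨τ, hτ, h⟩ := Metric.continuousAt_iff.1 hcont δ hδ
    refine ⟨τ, hτ, fun q hq => ?_⟩
    have := h (x := q) (by rwa [Real.dist_eq])
    rw [Real.dist_eq, Real.sqrt_one, inv_one] at this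
    exact this.le
  -- Off `N n` the factor √(n+1)/‖x‖ is within δ of 1. Off `B` at the scales 1 - δ, 1, 1 + δ the
  -- averages are close to Ψ there, and convexity in the scale fills the gap.
  let B : ℝ → ℕ → Set (ℕ → ℝ) := fun s n =>
    {x | η ≤ |(∑ i ∈ Finset.range (n + 1), F (s * x i)) / ((n : ℝ) + 1) - Ψ s|}
  let N : ℕ → Set (ℕ → ℝ) := fun n =>
    {x | τ ≤ |(∑ i ∈ Finset.range (n + 1), x i ^ 2) / ((n : ℝ) + 1) - ∫ z, z ^ 2 ∂γ|}
  have hB : ∀ s, ∑' n, Q (B s n) ≠ ⊤ := fun s =>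
    tsum_measure_scaled_mean_ne_top hF hd hint s hη0
  have hN : ∑' n, Q (N n) ≠ ⊤ :=
    tsum_measure_mean_ne_top (h := fun z => z ^ 2) (by fun_prop)
      integrable_sq_pow_four_gaussianReal hτ
  have hle : ∀ n : ℕ, uniformSphere n {θ | ε ≤ |(∑ i, F (Real.sqrt ((n : ℝ) + 1) * θ.1 i)) /
      ((n : ℝ) + 1) - ∫ z, F z ∂γ|} ≤ Q (N n) + Q (B (1 - δ) n) + Q (B 1 n) + Q (B (1 + δ) n) := by
    intro n
    have hA : MeasurableSet {y : EuclideanSpace ℝ (Fin (n + 1)) |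
        ε ≤ |(∑ i, F (Real.sqrt ((n : ℝ) + 1) * y i)) / ((n : ℝ) + 1) - ∫ z, F z ∂γ|} :=
      (isClosed_le continuous_const (by fun_prop)).measurableSet
    refine (uniformSphere_eq_gaussian n hA).trans_le ?_
    have hsub : {x | ‖initialVector n x‖⁻¹ • initialVector n x ∈
        {y : EuclideanSpace ℝ (Fin (n + 1)) |
          ε ≤ |(∑ i, F (Real.sqrt ((n : ℝ) + 1) * y i)) / ((n : ℝ) + 1) - ∫ z, F z ∂γ|}} ⊆
        N n ∪ B (1 - δ) n ∪ B 1 n ∪ B (1 + δ) n := by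
      intro x hx
      by_contra hcon
      simp only [Set.mem_union, not_or, N, B, Set.mem_ofPred_eq, not_le] at hcon hx
      obtain ⟨⟨⟨hN, hl⟩, hm⟩, hr⟩ := hcon
      rw [integral_sq_gaussianReal, ← norm_sq_initialVector] at hN
      have hs := hsqrt _ hN
      rw [Real.sqrt_div (by positivity), Real.sqrt_sq (norm_nonneg _), inv_div] at hs
      let T : ℝ → ℝ := fun s => (∑ i ∈ Finset.range (n + 1), F (s * x i)) / ((n : ℝ) + 1)
      have hT : ConvexOn ℝ Set.univ T := convexOn_sum_div _
        (fun i _ => hF.comp_linearMap (LinearMap.mulRight ℝ (x i))) (by positivity)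
      have d1 := hΨδ (1 - δ) (by simp [abs_of_pos hδ])
      have d2 := hΨδ (1 + δ) (by simp [abs_of_pos hδ])
      have hfin := abs_sub_le_of_convexOn hT (I := Ψ 1) (η := η) (δ := δ)
        (by have := abs_sub_le (T (1 - δ)) (Ψ (1 - δ)) (Ψ 1); linarith) hm.le
        (by have := abs_sub_le (T (1 + δ)) (Ψ (1 + δ)) (Ψ 1); linarith) hs
      have hTs : (∑ i, F (Real.sqrt ((n : ℝ) + 1) *
          (‖initialVector n x‖⁻¹ • initialVector n x) i)) / ((n : ℝ) + 1) =
          T (Real.sqrt ((n : ℝ) + 1) / ‖initialVector n x‖) := by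
        simp only [T]
        rw [← Fin.sum_univ_eq_sum_range
          (fun i => F (Real.sqrt ((n : ℝ) + 1) / ‖initialVector n x‖ * x i))]
        congr 1
        refine Finset.sum_congr rfl fun i _ => ?_
        congr 1
        simp [initialVector, div_eq_mul_inv, mul_assoc]
      rw [hTs, hΨ1] at hx
      linarith
    refine (measure_mono hsub).trans ?_
    refine (measure_union_le _ _).trans (add_le_add_left ((measure_union_le _ _).trans
      (add_le_add_left (measure_union_le _ _) _)) _)
  refine ne_top_of_le_ne_top ?_ (ENNReal.tsum_le_tsum hle)
  rw [ENNReal.tsum_add, ENNReal.tsum_add, ENNReal.tsum_add]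
  exact ENNReal.add_ne_top.2 ⟨ENNReal.add_ne_top.2 ⟨ENNReal.add_ne_top.2 ⟨hN, hB _⟩, hB _⟩, hB _⟩

/-- Borel–Cantelli with summable probabilities needs only the marginals of σ. -/
lemma ae_tendsto_average (hF : ConvexOn ℝ Set.univ F) (hd : DifferentiableAt ℝ F 0)
    (hint : ∀ s : ℝ, Integrable (fun z => F (s * z)) (gaussianReal 0 1))
    {σ : Measure WeightArray} (hσ : ∀ n, σ.map (fun θ => θ n) = uniformSphere n) :
    ∀ᵐ θ ∂σ, Tendsto (fun n : ℕ => (∑ i, F (Real.sqrt ((n : ℝ) + 1) * (θ n).1 i)) /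
      ((n : ℝ) + 1)) atTop (𝓝 (∫ z, F z ∂(gaussianReal 0 1))) := by
  have hc := continuous_of_convexOn_univ hF
  have h : ∀ k : ℕ, ∀ᵐ θ ∂σ, ∀ᶠ n : ℕ in atTop,
      |(∑ i, F (Real.sqrt ((n : ℝ) + 1) * (θ n).1 i)) / ((n : ℝ) + 1) -
        ∫ z, F z ∂(gaussianReal 0 1)| < 1 / ((k : ℝ) + 1) := by
    intro k
    have hk : (0 : ℝ) < 1 / ((k : ℝ) + 1) := by positivity
    have hsum := tsum_uniformSphere_ne_top hF hd hint hk
    have heq : ∀ n : ℕ, uniformSphere n {θ | 1 / ((k : ℝ) + 1) ≤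
        |(∑ i, F (Real.sqrt ((n : ℝ) + 1) * θ.1 i)) / ((n : ℝ) + 1) -
          ∫ z, F z ∂(gaussianReal 0 1)|} = σ {θ | 1 / ((k : ℝ) + 1) ≤
        |(∑ i, F (Real.sqrt ((n : ℝ) + 1) * (θ n).1 i)) / ((n : ℝ) + 1) -
          ∫ z, F z ∂(gaussianReal 0 1)|} := by
      intro n
      rw [← hσ n, Measure.map_apply (measurable_pi_apply n)
        (isClosed_le continuous_const (by fun_prop)).measurableSet]
      rfl
    simp_rw [heq] at hsum
    filter_upwards [ae_eventually_notMem hsum] with θ hθ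
    filter_upwards [hθ] with n hn
    simpa only [Set.mem_ofPred_eq, not_le] using hn
  filter_upwards [ae_all_iff.2 h] with θ hθ
  refine Metric.tendsto_atTop'.2 fun ε hε => ?_
  obtain ⟨k, hk⟩ := exists_nat_one_div_lt hε
  obtain ⟨m, hm⟩ := eventually_atTop.1 (hθ k)
  refine ⟨m, fun n hn => ?_⟩
  rw [Real.dist_eq]
  exact (hm n hn.le).trans hk

end EmpiricalAverage

/-! ### The weighted sums -/

section WeightedSum

variable {V : Type*} [NormedAddCommGroup V] [InnerProductSpace ℝ V] {Ω : Type*} {X : ℕ → Ω → V}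

lemma mul_inner_weightedSum (θ : WeightArray) (n : ℕ) (l : V) (ω : Ω) :
    ((n : ℝ) + 1) * inner ℝ l (weightedSum X θ n ω) =
      ∑ i : Fin (n + 1), inner ℝ ((Real.sqrt ((n : ℝ) + 1) * (θ n).1 i) • l) (X i ω) := by
  have hn : (0 : ℝ) < (n : ℝ) + 1 := by positivity
  rw [weightedSum, real_inner_smul_right, ← mul_assoc, ← div_eq_mul_inv, Real.div_sqrt, inner_sum,
    Finset.mul_sum]
  refine Finset.sum_congr rfl fun i _ => ?_
  rw [real_inner_smul_right, real_inner_smul_left, mul_assoc]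

variable [FiniteDimensional ℝ V] [MeasurableSpace Ω] {P : Measure Ω}

lemma aemeasurable_weightedSum [MeasurableSpace V] [BorelSpace V]
    (hX : ∀ i, AEMeasurable (X i) P) (θ : WeightArray) (n : ℕ) :
    AEMeasurable (weightedSum X θ n) P := by
  unfold weightedSum
  exact (Finset.aemeasurable_fun_sum _ fun (i : Fin (n + 1)) _ =>
    (hX i).const_smul ((θ n).1 i)).const_smul _

variable [IsProbabilityMeasure P]

/-- Almost surely, the averaged log-moment generating functions converge everywhere. -/
lemma ae_forall_tendsto_average_logMGF {Y : Ω → V}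
    (hfin : ∀ l : V, Integrable (fun ω => Real.exp (inner ℝ l (Y ω))) P)
    (hgauss : ∀ l : V, Integrable (fun z : ℝ => logMGF Y P (z • l)) (gaussianReal 0 1))
    {σ : Measure WeightArray} (hσ : ∀ n, σ.map (fun θ => θ n) = uniformSphere n) :
    ∀ᵐ θ ∂σ, ∀ l : V, Tendsto (fun n : ℕ =>
      (∑ i, logMGF Y P ((Real.sqrt ((n : ℝ) + 1) * (θ n).1 i) • l)) / ((n : ℝ) + 1)) atTop
      (𝓝 (gaussianAverage (logMGF Y P) l)) := by
  have hconv := convexOn_logMGF hfin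
  have hsmul : ∀ c : ℝ, ConvexOn ℝ Set.univ fun l : V => logMGF Y P (c • l) := fun c =>
    hconv.comp_linearMap (LinearMap.lsmul ℝ V c)
  -- The null set depends on l; countably many l are treated first, and convexity gives the rest.
  obtain ⟨D, hDc, hD⟩ := TopologicalSpace.exists_countable_dense V
  have h : ∀ l ∈ D, ∀ᵐ θ ∂σ, Tendsto (fun n : ℕ =>
      (∑ i, logMGF Y P ((Real.sqrt ((n : ℝ) + 1) * (θ n).1 i) • l)) / ((n : ℝ) + 1)) atTop
      (𝓝 (gaussianAverage (logMGF Y P) l)) := by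
    intro l _
    refine ae_tendsto_average (F := fun z => logMGF Y P (z • l)) ?_ ?_ (fun s => ?_) hσ
    · exact hconv.comp_linearMap (LinearMap.toSpanSingleton ℝ V l)
    · simpa using differentiable_logMGF_line hfin 0 l 0
    · simpa only [mul_comm s, mul_smul] using hgauss (s • l)
  filter_upwards [(ae_ball_iff hDc).2 h] with θ hθ l
  refine tendsto_of_convexOn_of_dense (F := fun n l =>
    (∑ i, logMGF Y P ((Real.sqrt ((n : ℝ) + 1) * (θ n).1 i) • l)) / ((n : ℝ) + 1)) hD
    (fun n => ?_) (continuous_of_convexOn_univ (convexOn_gaussianAverage hconv hgauss)) hθ l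
  exact convexOn_sum_div _ (fun i _ => hsmul _) (by positivity)

variable [MeasurableSpace V] [BorelSpace V]

lemma integral_exp_weightedSum (hindep : iIndepFun X P)
    (hident : ∀ i, IdentDistrib (X i) (X 0) P P)
    (hfin : ∀ l : V, Integrable (fun ω => Real.exp (inner ℝ l (X 0 ω))) P)
    (θ : WeightArray) (n : ℕ) (l : V) :
    ∫ ω, Real.exp (((n : ℝ) + 1) * inner ℝ l (weightedSum X θ n ω)) ∂P =
      Real.exp (∑ i, logMGF (X 0) P ((Real.sqrt ((n : ℝ) + 1) * (θ n).1 i) • l)) := by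
  simp_rw [mul_inner_weightedSum, Real.exp_sum]
  have h := (hindep.precomp (g := fun i : Fin (n + 1) => (i : ℕ))
    Fin.val_injective).integral_fun_prod_comp
    (f := fun i x => Real.exp (inner ℝ ((Real.sqrt ((n : ℝ) + 1) * (θ n).1 i) • l) x))
    (fun i => (hident i).aemeasurable_fst)
    (fun i => by
      exact (by fun_prop : Continuous _).aestronglyMeasurable)
  rw [h]
  refine Finset.prod_congr rfl fun i _ => ?_
  rw [exp_logMGF hfin]
  exact ((hident i).comp (u := fun x => Real.exp
    (inner ℝ ((Real.sqrt ((n : ℝ) + 1) * (θ n).1 i) • l) x)) (by fun_prop)).integral_eq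

lemma integrable_exp_map_weightedSum (hindep : iIndepFun X P)
    (hident : ∀ i, IdentDistrib (X i) (X 0) P P)
    (hfin : ∀ l : V, Integrable (fun ω => Real.exp (inner ℝ l (X 0 ω))) P)
    (θ : WeightArray) (n : ℕ) (l : V) :
    Integrable (fun x => Real.exp (((n : ℝ) + 1) * inner ℝ l x))
      (P.map (weightedSum X θ n)) := by
  rw [integrable_map_measure (by fun_prop)
    (aemeasurable_weightedSum (fun i => (hident i).aemeasurable_fst) θ n)]
  -- A non-integrable function has integral 0 by convention, but the computed value is an
  -- exponential.
  by_contra hcon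
  have h := integral_exp_weightedSum hindep hident hfin θ n l
  rw [show (∫ ω, Real.exp (((n : ℝ) + 1) * inner ℝ l (weightedSum X θ n ω)) ∂P) = 0 from
    integral_undef hcon] at h
  exact (Real.exp_pos _).ne h

lemma cgf_map_weightedSum (hindep : iIndepFun X P)
    (hident : ∀ i, IdentDistrib (X i) (X 0) P P)
    (hfin : ∀ l : V, Integrable (fun ω => Real.exp (inner ℝ l (X 0 ω))) P)
    (θ : WeightArray) (n : ℕ) (l : V) :
    cgf (fun x => inner ℝ l x) (P.map (weightedSum X θ n)) ((n : ℝ) + 1) =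
      ∑ i, logMGF (X 0) P ((Real.sqrt ((n : ℝ) + 1) * (θ n).1 i) • l) := by
  rw [cgf, mgf, integral_map (aemeasurable_weightedSum (fun i => (hident i).aemeasurable_fst) θ n)
    (by fun_prop), integral_exp_weightedSum hindep hident hfin, Real.log_exp]

end WeightedSum

end WeightedLDP

theorem mainTheorem2
    {V : Type*} [NormedAddCommGroup V] [InnerProductSpace ℝ V] [FiniteDimensional ℝ V]
    [MeasurableSpace V] [BorelSpace V]
    {Ω : Type*} [MeasurableSpace Ω] (P : Measure Ω) [IsProbabilityMeasure P]
    (X : ℕ → Ω → V)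
    (hindep : iIndepFun X P)
    (hident : ∀ i, IdentDistrib (X i) (X 0) P P)
    -- the log-moment generating function of `X 0` is finite
    (hfin : ∀ l : V, Integrable (fun ω => Real.exp (inner ℝ l (X 0 ω))) P)
    -- its Gaussian average is finite
    (hgauss : ∀ l : V,
      Integrable (fun z : ℝ => WeightedLDP.logMGF (X 0) P (z • l)) (gaussianReal 0 1))
    (σ : Measure WeightedLDP.WeightArray) [IsProbabilityMeasure σ]
    (hσ : ∀ n, σ.map (fun θ => θ n) = WeightedLDP.uniformSphere n) :
    ∀ᵐ θ ∂σ, WeightedLDP.SatisfiesLDP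
      (fun n => P.map (WeightedLDP.weightedSum X θ n))
      (fun n => (n : ℝ) + 1)
      (WeightedLDP.legendre (WeightedLDP.gaussianAverage (WeightedLDP.logMGF (X 0) P))) := by
  have hX : ∀ i, AEMeasurable (X i) P := fun i => (hident i).aemeasurable_fst
  have hconv := WeightedLDP.convexOn_logMGF hfin
  have h0 := WeightedLDP.logMGF_zero (Y := X 0) (P := P)
  filter_upwards [WeightedLDP.ae_forall_tendsto_average_logMGF hfin hgauss hσ] with θ hθ
  have hprob : ∀ n, IsProbabilityMeasure (P.map (WeightedLDP.weightedSum X θ n)) := fun n =>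
    Measure.isProbabilityMeasure_map (WeightedLDP.aemeasurable_weightedSum hX θ n)
  refine WeightedLDP.satisfiesLDP_of_tendsto_cgf
    (tendsto_atTop_add_const_right _ _ tendsto_natCast_atTop_atTop) (fun n => by positivity)
    (fun n l => WeightedLDP.integrable_exp_map_weightedSum hindep hident hfin θ n l) (fun l => ?_)
    (WeightedLDP.continuous_of_convexOn_univ (WeightedLDP.convexOn_gaussianAverage hconv hgauss))
    (WeightedLDP.gaussianAverage_nonneg hconv h0 hgauss)
    (WeightedLDP.gaussianAverage_zero h0)
    (WeightedLDP.differentiableAt_gaussianAverage_line hconv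
      (WeightedLDP.differentiable_logMGF_line hfin) hgauss)
  simp_rw [WeightedLDP.cgf_map_weightedSum hindep hident hfin]
  exact hθ l
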